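/- **Theorem (Quantitative quantum de Finetti).** Let $\mathfrak H$ be a complex Hilbert space of finite dimension $d$, let $N\ge 1$, and let $\mathfrak H_s^N\subset\mathfrak H^{\otimes N}$ be the subspace of permutation-symmetric vectors. Let $\Gamma_N$ be a bosonic $N$-body state, i.e. a positive self-adjoint operator of trace $1$ on $\mathfrak H_s^N$; extended by zero to $\mathfrak H^{\otimes N}$, this is a positive operator of trace $1$ with $U_\sigma\Gamma_N=\Gamma_N$ for every permutation $\sigma$ of the $N$ tensor factors, where $U_\sigma$ denotes the permutation unitary. Let $du$ be the uniform probability measure on the unit sphere $S\mathfrak H=\{u\in\mathfrak H:\|u\|=1\}$, and define the Christandl–König–Mitchison–Renner (lower symbol) measure $$d\mu_N(u)=\dim(\mathfrak H_s^N)\,\langle u^{\otimes N},\Gamma_N u^{\otimes N}\rangle\,du .$$ Then $\mu_N$ is a probability measure on $S\mathfrak H$, the integral $$\tilde\Gamma_N=\int_{S\mathfrak H}|u^{\otimes N}\rangle\langle u^{\otimes N}|\,d\mu_N(u)$$ converges and is a bosonic $N$-body state, and, writing $\gamma_N^{(n)}=\mathrm{Tr}_{n+1\to N}\,\Gamma_N$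 and $\tilde\gamma_N^{(n)}=\mathrm{Tr}_{n+1\to N}\,\tilde\Gamma_N$ for the reduced density matrices (partial traces over the last $N-n$ tensor factors, so that both have trace $1$), $$\mathrm{Tr}_{\mathfrak H^{\otimes n}}\bigl|\gamma_N^{(n)}-\tilde\gamma_N^{(n)}\bigr|\le\frac{2n(d+2n)}{N}\qquad\text{for all } n=1,\dots,N .$$ -/

import Mathlib

open scoped TensorProduct ENNReal

noncomputable section

namespace DeFinetti

section TensorPowers

variable (H : Type*) [NormedAddCommGroup H] [InnerProductSpace ℂ H]

/-- The `N`-body space `H ⊗ ⋯ ⊗ H` (`N` factors, `N = 0` gives a copy of `ℂ`). It is a separate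
type because it carries the Hilbert space structure below. -/
def NBody (N : ℕ) : Type _ := ⨂[ℂ] _ : Fin N, H

instance (N : ℕ) : AddCommGroup (NBody H N) :=
  inferInstanceAs (AddCommGroup (⨂[ℂ] _ : Fin N, H))

instance (N : ℕ) : Module ℂ (NBody H N) :=
  inferInstanceAs (Module ℂ (⨂[ℂ] _ : Fin N, H))

/-- The identity map from the algebraic tensor power to the `N`-body space. -/
def toNBody (N : ℕ) : (⨂[ℂ] _ : Fin N, H) ≃ₗ[ℂ] NBody H N :=
  LinearEquiv.refl ℂ (⨂[ℂ] _ : Fin N, H)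

variable {H}

/-- The elementary tensor `u₁ ⊗ ⋯ ⊗ u_N`. -/
def tprod {N : ℕ} (u : Fin N → H) : NBody H N := toNBody H N (PiTensorProduct.tprod ℂ u)

/-- The product (Hartree) vector `u ⊗ ⋯ ⊗ u`. -/
def tpow (N : ℕ) (u : H) : NBody H N := tprod fun _ => u

/-- The unitary `U_σ` permuting the `N` tensor factors. -/
def permute {N : ℕ} (σ : Equiv.Perm (Fin N)) : NBody H N →ₗ[ℂ] NBody H N :=
  ((toNBody H N).symm.trans
    ((PiTensorProduct.reindex ℂ (fun _ : Fin N => H) σ).trans (toNBody H N))).toLinearMap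

theorem permute_tprod {N : ℕ} (σ : Equiv.Perm (Fin N)) (u : Fin N → H) :
    permute σ (tprod u) = tprod fun i => u (σ.symm i) :=
  congrArg (toNBody H N) (PiTensorProduct.reindex_tprod σ u)

/-- The bosonic subspace of permutation invariant vectors. -/
def bosonic (H : Type*) [NormedAddCommGroup H] [InnerProductSpace ℂ H] (N : ℕ) :
    Submodule ℂ (NBody H N) :=
  ⨅ σ : Equiv.Perm (Fin N), LinearMap.eqLocus (permute σ) LinearMap.id

theorem mem_bosonic {N : ℕ} {x : NBody H N} : x ∈ bosonic H N ↔ ∀ σ, permute σ x = x := by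
  simp [bosonic, LinearMap.mem_eqLocus]

variable [FiniteDimensional ℂ H]

instance (N : ℕ) : FiniteDimensional ℂ (NBody H N) :=
  inferInstanceAs (Module.Finite ℂ (⨂[ℂ] _ : Fin N, H))

/-- The product basis of the `N`-body space coming from an orthonormal basis of `H`. -/
def prodBasis (H : Type*) [NormedAddCommGroup H] [InnerProductSpace ℂ H] [FiniteDimensional ℂ H]
    (N : ℕ) : Module.Basis (Fin N → Fin (Module.finrank ℂ H)) ℂ (NBody H N) :=
  (Basis.piTensorProduct fun _ : Fin N => (stdOrthonormalBasis ℂ H).toBasis).map (toNBody H N)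

theorem prodBasis_repr_tprod {N : ℕ} (u : Fin N → H) (I : Fin N → Fin (Module.finrank ℂ H)) :
    (prodBasis H N).repr (tprod u) I = ∏ i, inner ℂ (stdOrthonormalBasis ℂ H (I i)) (u i) := by
  simp [prodBasis, tprod, OrthonormalBasis.repr_apply_apply]

/-- The inner product making the product basis orthonormal; by `inner_tprod` below it is the usual
one, `⟨u₁ ⊗ ⋯ ⊗ u_N, v₁ ⊗ ⋯ ⊗ v_N⟩ = ∏ ⟨u_i, v_i⟩`, independently of the basis. -/
@[reducible] def innerCore (N : ℕ) : InnerProductSpace.Core ℂ (NBody H N) where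
  inner x y := ∑ I, (starRingEnd ℂ) ((prodBasis H N).repr x I) * (prodBasis H N).repr y I
  conj_inner_symm x y := by simp [map_sum, mul_comm]
  re_inner_nonneg x := by
    rw [map_sum]
    refine Finset.sum_nonneg fun I _ => ?_
    rw [← Complex.normSq_eq_conj_mul_self]
    simpa using Complex.normSq_nonneg _
  add_left x y z := by simp [add_mul, Finset.sum_add_distrib]
  smul_left x y r := by simp [Finset.mul_sum, mul_assoc]
  definite x hx := by
    have h : ∑ I, Complex.normSq ((prodBasis H N).repr x I) = 0 := by
      have : ((∑ I, Complex.normSq ((prodBasis H N).repr x I) : ℝ) : ℂ) = 0 := by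
        rw [← hx, Complex.ofReal_sum]
        exact Finset.sum_congr rfl fun I _ => Complex.normSq_eq_conj_mul_self
      exact_mod_cast this
    rw [Finset.sum_eq_zero_iff_of_nonneg fun I _ => Complex.normSq_nonneg _] at h
    refine (prodBasis H N).ext_elem fun I => ?_
    simpa using h I (Finset.mem_univ I)

instance (N : ℕ) : NormedAddCommGroup (NBody H N) := (innerCore N).toNormedAddCommGroup

instance (N : ℕ) : InnerProductSpace ℂ (NBody H N) :=
  InnerProductSpace.ofCore (innerCore N).toCore

instance (N : ℕ) : CompleteSpace (NBody H N) := FiniteDimensional.complete ℂ _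

theorem inner_tprod {N : ℕ} (u v : Fin N → H) :
    inner ℂ (tprod u) (tprod v) = ∏ i, inner ℂ (u i) (v i) := by
  have h : inner ℂ (tprod u) (tprod v) =
      ∑ I, (starRingEnd ℂ) ((prodBasis H N).repr (tprod u) I) *
        (prodBasis H N).repr (tprod v) I := rfl
  rw [h]
  simp only [prodBasis_repr_tprod, map_prod, inner_conj_symm, ← Finset.prod_mul_distrib]
  rw [← Fintype.prod_sum (fun i j => inner ℂ (u i) (stdOrthonormalBasis ℂ H j) *
    inner ℂ (stdOrthonormalBasis ℂ H j) (v i))]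
  exact Finset.prod_congr rfl fun i _ => (stdOrthonormalBasis ℂ H).sum_inner_mul_inner _ _

end TensorPowers

section States

variable {H : Type*} [NormedAddCommGroup H] [InnerProductSpace ℂ H] [FiniteDimensional ℂ H]

/-- Bosonic `N`-body states: positive (in particular self-adjoint) operators `Γ` of trace one on the
`N`-body space with `U_σ Γ = Γ` for all permutations `σ`. These are the density matrices on the
bosonic subspace, extended by zero on its orthogonal complement. -/
structure IsBosonicState {N : ℕ} (Γ : NBody H N →L[ℂ] NBody H N) : Prop where
  isPositive : Γ.IsPositive
  trace_eq_one : LinearMap.trace ℂ (NBody H N) Γ.toLinearMap = 1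
  symm : ∀ (σ : Equiv.Perm (Fin N)) (x : NBody H N), permute σ (Γ x) = Γ x

/-- The identification of `(n`-body space`) ⊗ ((N - n)`-body space`)` with the `N`-body space, the
first `n` particles coming from the first factor. -/
def join {n N : ℕ} (h : n ≤ N) : NBody H n ⊗[ℂ] NBody H (N - n) ≃ₗ[ℂ] NBody H N :=
  (TensorProduct.congr (toNBody H n).symm (toNBody H (N - n)).symm).trans
    ((PiTensorProduct.tmulEquiv (ι := Fin n) (ι₂ := Fin (N - n)) ℂ H).trans
      ((PiTensorProduct.reindex ℂ (fun _ => H)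
        (finSumFinEquiv.trans (finCongr (Nat.add_sub_cancel' h)))).trans (toNBody H N)))

theorem join_tprod {n N : ℕ} (h : n ≤ N) (u : Fin N → H) :
    join h ((tprod fun i => u (Fin.castLE h i)) ⊗ₜ[ℂ]
      (tprod fun j : Fin (N - n) => u (Fin.cast (Nat.add_sub_cancel' h) (Fin.natAdd n j)))) =
      tprod u := by
  simp only [join, tprod, LinearEquiv.trans_apply, TensorProduct.congr_tmul,
    LinearEquiv.symm_apply_apply, PiTensorProduct.tmulEquiv_apply]
  refine congrArg (toNBody H N) ((PiTensorProduct.reindex_tprod _ _).trans ?_)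
  congr 1
  funext k
  obtain ⟨s, rfl⟩ := (finSumFinEquiv.trans (finCongr (Nat.add_sub_cancel' h))).surjective k
  rw [Equiv.symm_apply_apply]
  rcases s with i | j
  · simp
    congr 1
  · simp

/-- The partial trace `id ⊗ Tr` over the second tensor factor. -/
def partialTrace (E F : Type*) [AddCommGroup E] [Module ℂ E] [FiniteDimensional ℂ E]
    [AddCommGroup F] [Module ℂ F] [FiniteDimensional ℂ F] :
    (E ⊗[ℂ] F →ₗ[ℂ] E ⊗[ℂ] F) →ₗ[ℂ] (E →ₗ[ℂ] E) :=
  (TensorProduct.rid ℂ (E →ₗ[ℂ] E)).toLinearMap ∘ₗ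
    LinearMap.lTensor (E →ₗ[ℂ] E) (LinearMap.trace ℂ F) ∘ₗ
      (homTensorHomEquiv ℂ E F E F).symm.toLinearMap

theorem partialTrace_map {E F : Type*} [AddCommGroup E] [Module ℂ E] [FiniteDimensional ℂ E]
    [AddCommGroup F] [Module ℂ F] [FiniteDimensional ℂ F] (A : E →ₗ[ℂ] E) (B : F →ₗ[ℂ] F) :
    partialTrace E F (TensorProduct.map A B) = LinearMap.trace ℂ F B • A := by
  have h : TensorProduct.map A B = homTensorHomEquiv ℂ E F E F (A ⊗ₜ B) := by simp
  have h' : (homTensorHomEquiv ℂ E F E F).symm (TensorProduct.map A B) = A ⊗ₜ B := by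
    rw [h, LinearEquiv.symm_apply_apply]
  simp only [partialTrace, LinearMap.comp_apply, LinearEquiv.coe_coe, h',
    LinearMap.lTensor_tmul, TensorProduct.rid_tmul]

/-- The defining property of the partial trace: `tr[A (id ⊗ Tr) X] = tr[(A ⊗ 1) X]`. -/
theorem trace_mul_partialTrace {E F : Type*} [AddCommGroup E] [Module ℂ E]
    [FiniteDimensional ℂ E] [AddCommGroup F] [Module ℂ F] [FiniteDimensional ℂ F]
    (A : E →ₗ[ℂ] E) (X : E ⊗[ℂ] F →ₗ[ℂ] E ⊗[ℂ] F) :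
    LinearMap.trace ℂ E (A ∘ₗ partialTrace E F X) =
      LinearMap.trace ℂ (E ⊗[ℂ] F) (TensorProduct.map A LinearMap.id ∘ₗ X) := by
  obtain ⟨t, rfl⟩ := (homTensorHomEquiv ℂ E F E F).surjective X
  induction t with
  | zero => simp
  | add x y hx hy => simp only [map_add, LinearMap.comp_add, hx, hy]
  | tmul B C =>
    have h : homTensorHomEquiv ℂ E F E F (B ⊗ₜ C) = TensorProduct.map B C := by simp
    rw [h, partialTrace_map, ← TensorProduct.map_comp, LinearMap.trace_tensorProduct']
    rw [LinearMap.comp_smul, map_smul, LinearMap.id_comp, smul_eq_mul, mul_comm]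

/-- The `n`-th reduced density matrix `tr_{n+1 → N} Γ` of an `N`-body operator `Γ`. -/
def reduced {n N : ℕ} (h : n ≤ N) (Γ : NBody H N →L[ℂ] NBody H N) :
    NBody H n →L[ℂ] NBody H n :=
  LinearMap.toContinuousLinearMap
    (partialTrace (NBody H n) (NBody H (N - n)) ((join h).symm.conj Γ.toLinearMap))

/-- The trace norm `Tr |A|`, `|A| = (A* A)^{1/2}`. -/
def traceNorm {E : Type*} [NormedAddCommGroup E] [InnerProductSpace ℂ E] [FiniteDimensional ℂ E]
    [CompleteSpace E] (A : E →L[ℂ] E) : ℝ :=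
  (LinearMap.trace ℂ E (CFC.abs A).toLinearMap).re

variable [MeasurableSpace H] [BorelSpace H]

/-- The uniform probability measure `du` on the unit sphere of `H`: the surface (cone) measure induced
by Lebesgue measure on the real vector space `H`, normalized to have total mass one. The normalization
removes the dependence on the basis fixing the scale of Lebesgue measure. If `H` is zero, the sphere
is empty. -/
def uniformSphere (H : Type*) [NormedAddCommGroup H] [InnerProductSpace ℂ H]
    [FiniteDimensional ℂ H] [MeasurableSpace H] [BorelSpace H] :
    MeasureTheory.Measure (Metric.sphere (0 : H) 1) :=
  ((Module.finBasis ℝ H).addHaar.toSphere Set.univ)⁻¹ •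
    (Module.finBasis ℝ H).addHaar.toSphere

/-- The lower symbol `dμ(u) = dim(H_s^N) ⟨u^{⊗N}, Γ u^{⊗N}⟩ du` of `Γ`. -/
def lowerSymbol {N : ℕ} (Γ : NBody H N →L[ℂ] NBody H N) :
    MeasureTheory.Measure (Metric.sphere (0 : H) 1) :=
  (uniformSphere H).withDensity fun u =>
    ENNReal.ofReal (Module.finrank ℂ (bosonic H N) *
      (inner ℂ (tpow N (u : H)) (Γ (tpow N (u : H)))).re)

/-- The superposition `∫ |u^{⊗N}⟩⟨u^{⊗N}| dμ(u)` of product states. -/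
def superposition (N : ℕ) (μ : MeasureTheory.Measure (Metric.sphere (0 : H) 1)) :
    NBody H N →L[ℂ] NBody H N :=
  ∫ u, InnerProductSpace.rankOne ℂ (tpow N (u : H)) (tpow N (u : H)) ∂μ

end States

end DeFinetti

end

/-! Write D and D' for the dimensions of the bosonic spaces of N and N - n particles, and γ, γ̃ for
the two reduced density matrices. The heart of the proof is the operator inequality γ̃ ≥ (D'/D) γ
(`IsBosonicState.re_inner_reduced_le`). Both sides come from trace one operators, so γ - γ̃ is a
difference of two positive operators of trace 1 - D'/D, and its trace norm is at most 2(1 - D'/D).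
Counting dimensions gives 1 - D'/D ≤ nd/N, which is better than required.

The inequality rests on the resolution of the identity D ∫ |u^N⟩⟨u^N| du = 1 on bosonic vectors
(`finrank_smul_superposition_uniform_apply`). Inserted into ⟨w, γ w⟩ in two ways, it gives D' ∫ ⟨w ⊗
u^(N-n), Γ (w ⊗ u^(N-n))⟩ du and D ∫ ⟨w, u^n⟩ ⟨u^N, Γ (w ⊗ u^(N-n))⟩ du, while ⟨w, γ̃ w⟩ = D ∫ |⟨w,
u^n⟩|² ⟨u^N, Γ u^N⟩ du. These are the diagonal and cross terms of the quadratic form of Γ at a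
combination of w ⊗ u^(N-n) and u^N. Positivity of Γ, integrated over u with the best coefficients,
is the claim.

The resolution of the identity is computed from the moments of the sphere: in polar coordinates they
are Gaussian moments up to a common factor, and these factorize over coordinates. The constant is
then fixed by taking a trace. -/

noncomputable section

namespace DeFinetti

/-! ### Dimension of the bosonic subspace and its growth in the particle number -/

section Dimension

/-- The dimension `C(M + d, d)` grows slowly in `M`. -/
theorem choose_ratio_bound (M n d : ℕ) (h : 0 < M + n) :
    (1 - (n : ℝ) * d / ((M + n : ℕ) : ℝ)) * ((M + n + d).choose d : ℝ) ≤
      ((M + d).choose d : ℝ) := by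
  have hN : (0 : ℝ) < ((M + n : ℕ) : ℝ) := by exact_mod_cast h
  induction d with
  | zero => simp
  | succ d ih =>
    have h1 : (M + n + d + 1 : ℝ) * ((M + n + d).choose d : ℝ) =
        ((M + n + (d + 1)).choose (d + 1) : ℝ) * (d + 1) := by
      exact_mod_cast Nat.add_one_mul_choose_eq (M + n + d) d
    have h2 : (M + d + 1 : ℝ) * ((M + d).choose d : ℝ) =
        ((M + (d + 1)).choose (d + 1) : ℝ) * (d + 1) := by
      exact_mod_cast Nat.add_one_mul_choose_eq (M + d) d
    have hd : (0 : ℝ) < d + 1 := by positivity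
    rw [← mul_le_mul_iff_left₀ hd, ← h2, mul_assoc, ← h1]
    refine le_trans ?_ (mul_le_mul_of_nonneg_left ih (by positivity))
    have hC : (0 : ℝ) ≤ ((M + n + d).choose d : ℝ) := by positivity
    -- Raising d by one multiplies the ratio of binomials by (M+d+1)/(M+n+d+1) = 1 - n/(M+n+d+1), at
    -- least 1 - n/(M+n). This is what remains once the common binomial is factored out.
    suffices hs : (1 - (n : ℝ) * ((d + 1 : ℕ) : ℝ) / ((M + n : ℕ) : ℝ)) * (M + n + d + 1) ≤
        (M + d + 1) * (1 - (n : ℝ) * d / ((M + n : ℕ) : ℝ)) by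
      nlinarith [mul_le_mul_of_nonneg_right hs hC]
    rw [← mul_le_mul_iff_left₀ hN]
    have e : ∀ a b : ℝ, (1 - a / ((M + n : ℕ) : ℝ)) * b * ((M + n : ℕ) : ℝ) =
        (((M + n : ℕ) : ℝ) - a) * b := fun a b => by field_simp
    have e' : ∀ a b : ℝ, b * (1 - a / ((M + n : ℕ) : ℝ)) * ((M + n : ℕ) : ℝ) =
        b * (((M + n : ℕ) : ℝ) - a) := fun a b => by field_simp
    rw [e, e']
    push_cast
    have hn : (0 : ℝ) ≤ n := by positivity
    have hdd : (0 : ℝ) ≤ d := by positivity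
    have hM : (0 : ℝ) ≤ M := by positivity
    nlinarith [mul_nonneg hn hn, mul_nonneg hn hdd, mul_nonneg (mul_nonneg hn hn) hdd,
      mul_nonneg hM hn]

/-- The unordered tuple underlying a tuple. -/
def toSym {α : Type*} {N : ℕ} (I : Fin N → α) : Sym α N :=
  ⟨Multiset.map I Finset.univ.val, by simp⟩

theorem toSym_surjective {α : Type*} {N : ℕ} : Function.Surjective (toSym : (Fin N → α) → _) := by
  rintro ⟨s, hs⟩
  induction s using Quotient.inductionOn with
  | h l =>
    have hl : l.length = N := by simpa using hs
    subst hl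
    refine ⟨fun i => l.get i, Subtype.ext ?_⟩
    simp [toSym]

/-- Fibres over the same point have equal size, so bijections between them glue to a permutation. -/
theorem exists_perm_of_card_fiber_eq {α β : Type*} [Fintype α] [DecidableEq β] {f g : α → β}
    (h : ∀ b, Fintype.card {a // f a = b} = Fintype.card {a // g a = b}) :
    ∃ σ : Equiv.Perm α, f ∘ σ = g := by
  refine ⟨Equiv.ofFiberEquiv (f := g) (g := f) fun b => Fintype.equivOfCardEq (h b).symm, ?_⟩
  funext a
  exact Equiv.ofFiberEquiv_map _ a

theorem toSym_eq_iff {α : Type*} [DecidableEq α] {N : ℕ} {I J : Fin N → α} :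
    toSym I = toSym J ↔ ∃ σ : Equiv.Perm (Fin N), I ∘ σ = J := by
  constructor
  · intro h
    refine exists_perm_of_card_fiber_eq fun b => ?_
    have := congrArg (Multiset.count b) (congrArg Subtype.val h)
    simp only [toSym, Multiset.count_map] at this
    simp only [Fintype.card_subtype]
    simpa [Finset.card_def, Finset.filter_val, eq_comm] using this
  · rintro ⟨σ, rfl⟩
    refine Subtype.ext ?_
    simp only [toSym]
    rw [← Multiset.map_map, Multiset.map_univ_val_equiv]

variable {H : Type*} [NormedAddCommGroup H] [InnerProductSpace ℂ H] [FiniteDimensional ℂ H]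

theorem prodBasis_apply {N : ℕ} (I : Fin N → Fin (Module.finrank ℂ H)) :
    prodBasis H N I = tprod fun i => stdOrthonormalBasis ℂ H (I i) := by
  simp [prodBasis, tprod]

theorem prodBasis_repr_permute {N : ℕ} (σ : Equiv.Perm (Fin N)) (x : NBody H N)
    (I : Fin N → Fin (Module.finrank ℂ H)) :
    (prodBasis H N).repr (permute σ x) I = (prodBasis H N).repr x (I ∘ σ) := by
  have : (Finsupp.lapply I ∘ₗ (prodBasis H N).repr.toLinearMap ∘ₗ permute σ : NBody H N →ₗ[ℂ] ℂ) =
      Finsupp.lapply (I ∘ σ) ∘ₗ (prodBasis H N).repr.toLinearMap := by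
    refine (prodBasis H N).ext fun J => ?_
    simp only [LinearMap.comp_apply, LinearEquiv.coe_coe, Finsupp.lapply_apply]
    rw [prodBasis_apply, permute_tprod, prodBasis_repr_tprod, prodBasis_repr_tprod,
      ← Equiv.prod_comp σ]
    simp
  exact LinearMap.congr_fun this x

theorem mem_bosonic_iff_repr {N : ℕ} {x : NBody H N} :
    x ∈ bosonic H N ↔ ∀ (σ : Equiv.Perm (Fin N)) (I : Fin N → Fin (Module.finrank ℂ H)),
      (prodBasis H N).repr x (I ∘ σ) = (prodBasis H N).repr x I := by
  rw [mem_bosonic]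
  refine forall_congr' fun σ => ?_
  constructor
  · intro h I
    rw [← prodBasis_repr_permute, h]
  · intro h
    refine (prodBasis H N).ext_elem fun I => ?_
    rw [prodBasis_repr_permute, h]

/-- The vector whose coefficients are given by a function on unordered tuples. -/
def ofSym (H : Type*) [NormedAddCommGroup H] [InnerProductSpace ℂ H] [FiniteDimensional ℂ H]
    (N : ℕ) : (Sym (Fin (Module.finrank ℂ H)) N → ℂ) →ₗ[ℂ] NBody H N :=
  (prodBasis H N).equivFun.symm.toLinearMap ∘ₗ LinearMap.funLeft ℂ ℂ toSym

theorem ofSym_injective (N : ℕ) : Function.Injective (ofSym H N) :=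
  (prodBasis H N).equivFun.symm.injective.comp
    (LinearMap.funLeft_injective_of_surjective ℂ ℂ _ toSym_surjective)

theorem repr_ofSym {N : ℕ} (f : Sym (Fin (Module.finrank ℂ H)) N → ℂ)
    (I : Fin N → Fin (Module.finrank ℂ H)) :
    (prodBasis H N).repr (ofSym H N f) I = f (toSym I) := by
  exact congrFun ((prodBasis H N).equivFun.apply_symm_apply (LinearMap.funLeft ℂ ℂ toSym f)) I

theorem range_ofSym (N : ℕ) : LinearMap.range (ofSym H N) = bosonic H N := by
  ext x
  rw [mem_bosonic_iff_repr]
  constructor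
  · rintro ⟨f, rfl⟩ σ I
    rw [repr_ofSym, repr_ofSym, (toSym_eq_iff.2 ⟨σ, rfl⟩ : toSym I = toSym (I ∘ σ))]
  · intro h
    refine ⟨fun s => (prodBasis H N).repr x (Function.surjInv toSym_surjective s), ?_⟩
    refine (prodBasis H N).ext_elem fun I => ?_
    rw [repr_ofSym]
    obtain ⟨σ, hσ⟩ := toSym_eq_iff.1 (Function.surjInv_eq toSym_surjective (toSym I))
    rw [← h σ, hσ]

/-- Symmetric vectors are those whose coefficients depend only on the unordered index tuple, so the
dimension counts multisets of size N in a set of d elements. -/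
theorem finrank_bosonic (N : ℕ) :
    Module.finrank ℂ (bosonic H N) = Nat.multichoose (Module.finrank ℂ H) N := by
  rw [← range_ofSym, LinearMap.finrank_range_of_inj (ofSym_injective N), Module.finrank_fintype_fun_eq_card,
    Sym.card_sym_eq_multichoose, Fintype.card_fin]

theorem finrank_bosonic_ratio [Nontrivial H] {n N : ℕ} (hN : 1 ≤ N) (hn : n ≤ N) :
    (1 - (n : ℝ) * Module.finrank ℂ H / N) * Module.finrank ℂ (bosonic H N) ≤
      Module.finrank ℂ (bosonic H (N - n)) := by
  obtain ⟨M, rfl⟩ := Nat.exists_eq_add_of_le' hn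
  obtain ⟨d, hd⟩ := Nat.exists_eq_add_of_lt (Module.finrank_pos (R := ℂ) (M := H))
  rw [finrank_bosonic, finrank_bosonic, hd, Nat.add_sub_cancel]
  have e : ∀ k, Nat.multichoose (0 + d + 1) k = (k + d).choose d := fun k => by
    rw [Nat.multichoose_eq, ← Nat.choose_symm_add]
    congr 1
    omega
  rw [e, e]
  -- Here d is one less than the dimension of `H`; the factor is weakened from d to d + 1.
  refine le_trans (mul_le_mul_of_nonneg_right ?_ (by positivity)) (choose_ratio_bound M n d hN)
  have : (n : ℝ) * d / ((M + n : ℕ) : ℝ) ≤ (n : ℝ) * ((0 + d + 1 : ℕ) : ℝ) / ((M + n : ℕ) : ℝ) := by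
    gcongr
    omega
  linarith

end Dimension

/-! ### Trace norm estimates for differences of positive operators -/

section TraceNorm

open ContinuousLinearMap

variable {E : Type*} [NormedAddCommGroup E] [InnerProductSpace ℂ E] [FiniteDimensional ℂ E]
  [CompleteSpace E]

omit [FiniteDimensional ℂ E] in
-- With B = |A|, B² = A² gives (B + |r|)(B - |r|) e = 0, so g = (B - |r|) e satisfies B g = -|r| g.
-- Positivity of B forces g = 0 if r ≠ 0; if r = 0, then ‖B e‖² = ⟨e, B² e⟩ = 0.
theorem abs_apply_of_eigenvector {A : E →L[ℂ] E} (hA : IsSelfAdjoint A) {e : E} {r : ℝ}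
    (he : A e = (r : ℂ) • e) : CFC.abs A e = ((|r| : ℝ) : ℂ) • e := by
  set B := CFC.abs A with hB
  have hpos : B.IsPositive := (nonneg_iff_isPositive B).1 (CFC.abs_nonneg A)
  have hsq : B (B e) = ((r ^ 2 : ℝ) : ℂ) • e := by
    have h : (B * B) e = (A * A) e := by rw [hB, CFC.abs_mul_abs, hA.star_eq]
    simp only [mul_apply_eq_comp, he, map_smul, smul_smul] at h
    rw [h]
    push_cast
    rw [sq]
  set g := B e - ((|r| : ℝ) : ℂ) • e with hg
  have hBg : B g = -(((|r| : ℝ) : ℂ) • g) := by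
    rw [hg, map_sub, map_smul, hsq, smul_sub, smul_smul, ← sq_abs r]
    push_cast
    rw [sq]
    abel
  have h0 : 0 ≤ (inner ℂ (B g) g).re := hpos.re_inner_nonneg_left g
  rw [hBg, inner_neg_left, inner_smul_left, inner_self_eq_norm_sq_to_K] at h0
  have h1 : |r| * ‖g‖ ^ 2 ≤ 0 := by
    have : (-((starRingEnd ℂ) ((|r| : ℝ) : ℂ) * ((‖g‖ : ℂ) ^ 2))).re = -(|r| * ‖g‖ ^ 2) := by
      rw [Complex.conj_ofReal]
      norm_cast
    exact neg_nonneg.1 (this ▸ h0)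
  suffices hg0 : g = 0 from sub_eq_zero.1 hg0
  by_cases hr : r = 0
  · have hBe : inner ℂ (B e) (B e) = (0 : ℂ) := by
      have := hpos.isSelfAdjoint.isSymmetric e (B e)
      rw [ContinuousLinearMap.coe_coe] at this
      rw [this, hsq, hr]
      simp
    rw [hg, inner_self_eq_zero.1 hBe, hr]
    simp
  · have : 0 < |r| := abs_pos.2 hr
    have : ‖g‖ ^ 2 ≤ 0 := by
      by_contra hc
      nlinarith [mul_pos this (not_le.1 hc)]
    exact norm_eq_zero.1 (pow_eq_zero_iff two_ne_zero |>.1 (le_antisymm this (sq_nonneg _)))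

/-- In an eigenbasis of P - Q each eigenvalue is ⟨b, P b⟩ - ⟨b, Q b⟩, a difference of nonnegative
numbers, so its modulus is at most their sum. -/
theorem traceNorm_sub_le {P Q : E →L[ℂ] E} (hP : P.IsPositive) (hQ : Q.IsPositive) :
    traceNorm (P - Q) ≤ (LinearMap.trace ℂ E P.toLinearMap).re +
      (LinearMap.trace ℂ E Q.toLinearMap).re := by
  have hA : IsSelfAdjoint (P - Q) := hP.isSelfAdjoint.sub hQ.isSelfAdjoint
  have hS : (P - Q).toLinearMap.IsSymmetric := hA.isSymmetric
  set b := hS.eigenvectorBasis rfl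
  have hb : ∀ i, (P - Q) (b i) = ((hS.eigenvalues rfl i : ℝ) : ℂ) • b i :=
    fun i => hS.apply_eigenvectorBasis rfl i
  rw [traceNorm, LinearMap.trace_eq_sum_inner _ b, LinearMap.trace_eq_sum_inner _ b,
    LinearMap.trace_eq_sum_inner _ b, Complex.re_sum, Complex.re_sum, Complex.re_sum,
    ← Finset.sum_add_distrib]
  refine Finset.sum_le_sum fun i _ => ?_
  simp only [ContinuousLinearMap.coe_coe]
  have hbi : inner ℂ (b i) (b i) = (1 : ℂ) := by
    rw [inner_self_eq_norm_sq_to_K, b.norm_eq_one]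
    simp
  have h1 : (inner ℂ (b i) ((P - Q) (b i))).re = hS.eigenvalues rfl i := by
    rw [hb, inner_smul_right, hbi, mul_one, Complex.ofReal_re]
  rw [sub_apply, inner_sub_right, Complex.sub_re] at h1
  rw [abs_apply_of_eigenvector hA (hb i), inner_smul_right, hbi, mul_one, Complex.ofReal_re, ← h1]
  have hp : 0 ≤ (inner ℂ (b i) (P (b i))).re := hP.re_inner_nonneg_right (b i)
  have hq : 0 ≤ (inner ℂ (b i) (Q (b i))).re := hQ.re_inner_nonneg_right (b i)
  rw [abs_le]
  constructor <;> linarith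

/-- Two trace one operators one of which dominates a multiple of the other are close. -/
theorem traceNorm_sub_le_of_smul_le {A B : E →L[ℂ] E} {c : ℝ} (hA : A.IsPositive)
    (hc : c ≤ 1) (hAB : (B - (c : ℂ) • A).IsPositive)
    (htA : LinearMap.trace ℂ E A.toLinearMap = 1) (htB : LinearMap.trace ℂ E B.toLinearMap = 1) :
    traceNorm (A - B) ≤ 2 * (1 - c) := by
  have hP : (((1 - c : ℝ) : ℂ) • A).IsPositive := by
    refine hA.smul_of_nonneg ?_
    exact_mod_cast sub_nonneg.2 hc
  have h := traceNorm_sub_le hP hAB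
  -- Both operators on the left are positive of trace 1 - c.
  have e : ((1 - c : ℝ) : ℂ) • A - (B - (c : ℂ) • A) = A - B := by
    push_cast
    module
  have e1 : (LinearMap.trace ℂ E (((1 - c : ℝ) : ℂ) • A).toLinearMap).re = 1 - c := by
    rw [ContinuousLinearMap.toLinearMap_smul, map_smul, htA]
    simp
  have e2 : (LinearMap.trace ℂ E (B - (c : ℂ) • A).toLinearMap).re = 1 - c := by
    rw [ContinuousLinearMap.toLinearMap_sub, ContinuousLinearMap.toLinearMap_smul, map_sub,
      map_smul, htA, htB]
    simp
  rw [e, e1, e2] at h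
  linarith

end TraceNorm

/-! ### Gaussian moments and moments of the uniform measure on the sphere -/

section Gaussian

open MeasureTheory

theorem integral_pow_mul_conj_pow_mul_gaussian (a b : ℕ) :
    ∫ z : ℂ, z ^ a * (starRingEnd ℂ z) ^ b * ((Real.exp (-‖z‖ ^ 2) : ℝ) : ℂ) =
      if a = b then ((Real.pi * a.factorial : ℝ) : ℂ) else 0 := by
  split_ifs with h
  · subst h
    have e : ∀ z : ℂ, z ^ a * (starRingEnd ℂ z) ^ a * ((Real.exp (-‖z‖ ^ 2) : ℝ) : ℂ) =
        ((‖z‖ ^ ((2 * a : ℕ) : ℝ) * Real.exp (-‖z‖ ^ (2 : ℝ)) : ℝ) : ℂ) := fun z => by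
      rw [← mul_pow, Complex.mul_conj', Real.rpow_natCast, ← pow_mul]
      norm_num
    simp_rw [e]
    rw [integral_complex_ofReal, Complex.integral_rpow_mul_exp_neg_rpow (by norm_num)
      (by push_cast; linarith [(Nat.cast_nonneg a : (0 : ℝ) ≤ a)])]
    congr 1
    rw [show (((2 * a : ℕ) : ℝ) + 2) / 2 = (a : ℝ) + 1 by push_cast; ring,
      Real.Gamma_nat_eq_factorial]
    ring
  · set f : ℂ → ℂ := fun z =>
      z ^ a * (starRingEnd ℂ z) ^ b * ((Real.exp (-‖z‖ ^ 2) : ℝ) : ℂ) with hf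
    have hab : (a : ℝ) - b ≠ 0 := sub_ne_zero.2 (by exact_mod_cast h)
    -- Rotation by this angle multiplies the integrand by exp(iθ(a - b)) = -1 and preserves Lebesgue
    -- measure, so the integral vanishes.
    set θ : ℝ := Real.pi / (a - b)
    have h1 : ∀ z, f (rotation (Circle.exp θ) z) = -f z := fun z => by
      have hn : ‖rotation (Circle.exp θ) z‖ = ‖z‖ := LinearIsometryEquiv.norm_map _ _
      have hr : rotation (Circle.exp θ) z = Complex.exp (θ * Complex.I) * z := by simp
      have hc : starRingEnd ℂ (Complex.exp (θ * Complex.I)) = Complex.exp (-(θ * Complex.I)) := by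
        rw [← Complex.exp_conj]
        simp
      have hm : Complex.exp (θ * Complex.I) ^ a * Complex.exp (-(θ * Complex.I)) ^ b = -1 := by
        rw [← Complex.exp_nat_mul, ← Complex.exp_nat_mul, ← Complex.exp_add, ← Complex.exp_pi_mul_I]
        congr 1
        have : θ * ((a : ℝ) - b) = Real.pi := div_mul_cancel₀ _ hab
        have h2 : ((θ : ℂ) * ((a : ℂ) - b)) = Real.pi := by exact_mod_cast this
        rw [← h2]
        ring
      simp only [hf]
      rw [hn, hr, map_mul, mul_pow, mul_pow, hc]
      linear_combination (z ^ a * (starRingEnd ℂ z) ^ b * ((Real.exp (-‖z‖ ^ 2) : ℝ) : ℂ)) * hm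
    have h2 : ∫ z, f (rotation (Circle.exp θ) z) = ∫ z, f z :=
      (rotation (Circle.exp θ)).measurePreserving.integral_comp
        (rotation (Circle.exp θ)).toHomeomorph.measurableEmbedding f
    simp_rw [h1] at h2
    rw [integral_neg] at h2
    exact self_eq_neg.1 h2.symm

/-- The integral factorizes over the coordinates k, with exponents the multiplicities of k in `I`
and in `J`. Every factor is nonzero only if all multiplicities agree, that is, if `J` rearranges
`I`. The product of their factorials is then the order of the stabilizer of `I`. -/
theorem integral_monomial_mul_gaussian {d N : ℕ} (I J : Fin N → Fin d) :
    ∫ z : Fin d → ℂ, (∏ i, z (I i) * starRingEnd ℂ (z (J i))) *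
        ((Real.exp (-∑ k, ‖z k‖ ^ 2) : ℝ) : ℂ) =
      if ∃ σ : Equiv.Perm (Fin N), I ∘ σ = J then
        (Real.pi : ℂ) ^ d * Fintype.card {g : Equiv.Perm (Fin N) // I ∘ g = I} else 0 := by
  have e : ∀ z : Fin d → ℂ, (∏ i, z (I i) * starRingEnd ℂ (z (J i))) *
      ((Real.exp (-∑ k, ‖z k‖ ^ 2) : ℝ) : ℂ) =
      ∏ k, (z k ^ Fintype.card {i // I i = k} * (starRingEnd ℂ (z k)) ^ Fintype.card {i // J i = k} *
        ((Real.exp (-‖z k‖ ^ 2) : ℝ) : ℂ)) := fun z => by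
    have hp : ∀ (K : Fin N → Fin d) (w : Fin d → ℂ),
        ∏ i, w (K i) = ∏ k, w k ^ Fintype.card {i // K i = k} := fun K w => by
      rw [← Finset.prod_fiberwise Finset.univ K]
      refine Finset.prod_congr rfl fun k _ => ?_
      rw [Fintype.card_subtype, ← Finset.prod_const]
      refine Finset.prod_congr rfl fun i hi => ?_
      rw [(Finset.mem_filter.1 hi).2]
    rw [Finset.prod_mul_distrib, Finset.prod_mul_distrib, Finset.prod_mul_distrib, hp I z,
      hp J fun k => starRingEnd ℂ (z k), ← Finset.sum_neg_distrib, Real.exp_sum]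
    push_cast
    rfl
  simp_rw [e]
  rw [integral_fintype_prod_volume_eq_prod (fun k (z : ℂ) =>
    z ^ Fintype.card {i // I i = k} * (starRingEnd ℂ z) ^ Fintype.card {i // J i = k} *
        ((Real.exp (-‖z‖ ^ 2) : ℝ) : ℂ))]
  simp_rw [integral_pow_mul_conj_pow_mul_gaussian]
  split_ifs with h
  · obtain ⟨σ, rfl⟩ := h
    have hc : ∀ k, Fintype.card {i // I i = k} = Fintype.card {i // (I ∘ σ) i = k} := fun k =>
      (Fintype.card_congr (σ.subtypeEquiv fun i => Iff.rfl)).symm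
    rw [DomMulAct.stabilizer_card]
    simp_rw [if_pos (hc _)]
    push_cast
    rw [Finset.prod_mul_distrib, Finset.prod_const, Finset.card_univ, Fintype.card_fin]
  · obtain ⟨k, hk⟩ : ∃ k, Fintype.card {i // I i = k} ≠ Fintype.card {i // J i = k} := by
      by_contra! hc
      exact h (exists_perm_of_card_fiber_eq hc)
    exact Finset.prod_eq_zero (Finset.mem_univ k) (if_neg hk)

variable {H : Type*} [NormedAddCommGroup H] [InnerProductSpace ℂ H] [FiniteDimensional ℂ H]
  [MeasurableSpace H] [BorelSpace H]

/-- Polar coordinates for homogeneous functions against a Gaussian weight. -/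
theorem integral_homogeneous_mul_gaussian {E : Type*} [NormedAddCommGroup E] [NormedSpace ℝ E]
    [FiniteDimensional ℝ E] [Nontrivial E] [MeasurableSpace E] [BorelSpace E] (μ : Measure E)
    [μ.IsAddHaarMeasure] (p : ℕ) {f : E → ℂ}
    (hf : ∀ (r : ℝ) (x : E), 0 < r → f (r • x) = (r : ℂ) ^ p * f x) :
    ∫ x, f x * ((Real.exp (-‖x‖ ^ 2) : ℝ) : ℂ) ∂μ =
      (∫ u : Metric.sphere (0 : E) 1, f u ∂μ.toSphere) *
        ∫ r : Set.Ioi (0 : ℝ), (r : ℂ) ^ p * ((Real.exp (-(r : ℝ) ^ 2) : ℝ) : ℂ)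
          ∂Measure.volumeIoiPow (Module.finrank ℝ E - 1) := by
  calc
    _ = ∫ x : ({(0)}ᶜ : Set E), f x * ((Real.exp (-‖(x : E)‖ ^ 2) : ℝ) : ℂ) ∂(μ.comap (↑)) := by
      rw [integral_subtype_comap (measurableSet_singleton _).compl
        fun x => f x * ((Real.exp (-‖x‖ ^ 2) : ℝ) : ℂ), restrict_compl_singleton]
    _ = ∫ x : Metric.sphere (0 : E) 1 × Set.Ioi (0 : ℝ),
          f x.1 * ((x.2 : ℂ) ^ p * ((Real.exp (-(x.2 : ℝ) ^ 2) : ℝ) : ℂ))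
          ∂μ.toSphere.prod (.volumeIoiPow (Module.finrank ℝ E - 1)) := by
      rw [← μ.measurePreserving_homeomorphUnitSphereProd.integral_comp
        (Homeomorph.measurableEmbedding _)]
      refine integral_congr_ae (Filter.Eventually.of_forall fun x => ?_)
      have hx : 0 < ‖(x : E)‖ := norm_pos_iff.2 x.2
      have h1 : f x = (‖(x : E)‖ : ℂ) ^ p * f (‖(x : E)‖⁻¹ • (x : E)) := by
        rw [← hf _ _ hx, smul_inv_smul₀ hx.ne']
      simp only [homeomorphUnitSphereProd_apply_snd_coe, homeomorphUnitSphereProd_apply_fst_coe]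
      rw [h1]
      ring
    _ = _ := integral_prod_mul (fun u : Metric.sphere (0 : E) 1 => f u)
          (fun r : Set.Ioi (0 : ℝ) => (r : ℂ) ^ p * ((Real.exp (-(r : ℝ) ^ 2) : ℝ) : ℂ))

/-- The moments of the uniform measure on the sphere. -/
theorem exists_integral_sphere_monomial [Nontrivial H] (N : ℕ) :
    ∃ C : ℂ, ∀ I J : Fin N → Fin (Module.finrank ℂ H),
      ∫ u : Metric.sphere (0 : H) 1, (∏ i, inner ℂ (stdOrthonormalBasis ℂ H (I i)) (u : H) *
        starRingEnd ℂ (inner ℂ (stdOrthonormalBasis ℂ H (J i)) (u : H))) ∂uniformSphere H =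
      if ∃ σ : Equiv.Perm (Fin N), I ∘ σ = J then
        C * Fintype.card {g : Equiv.Perm (Fin N) // I ∘ g = I} else 0 := by
  set μ := (Module.finBasis ℝ H).addHaar
  have : FiniteDimensional ℝ H := FiniteDimensional.complexToReal H
  set b := stdOrthonormalBasis ℂ H
  let φ : H ≃L[ℝ] (Fin (Module.finrank ℂ H) → ℂ) :=
    (b.toBasis.equivFun.restrictScalars ℝ).toContinuousLinearEquiv
  have hφ : ∀ x k, φ x k = inner ℂ (b k) x := fun x k => by
    simp [φ, ← OrthonormalBasis.repr_apply_apply]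
  have hnorm : ∀ x, ‖x‖ ^ 2 = ∑ k, ‖φ x k‖ ^ 2 := fun x => by
    simp_rw [hφ]
    exact (b.sum_sq_norm_inner_right x).symm
  -- By uniqueness of Haar measure, passing to coordinates only costs a positive constant, whose
  -- value is irrelevant.
  set κ := (μ.map φ).addHaarScalarFactor volume
  have hκ : μ.map φ = κ • volume := Measure.isAddLeftInvariant_eq_smul _ _
  have hκ0 : (κ : ℂ) ≠ 0 := by
    exact_mod_cast (Measure.addHaarScalarFactor_pos_of_isAddHaarMeasure _ _).ne'
  let F : (I J : Fin N → Fin (Module.finrank ℂ H)) → H → ℂ := fun I J x =>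
    ∏ i, inner ℂ (b (I i)) x * starRingEnd ℂ (inner ℂ (b (J i)) x)
  have hF : ∀ I J (r : ℝ) (x : H), 0 < r → F I J (r • x) = (r : ℂ) ^ (2 * N) * F I J x := by
    intro I J r x _
    simp only [F]
    have : ∀ i, inner ℂ (b (I i)) (r • x) * starRingEnd ℂ (inner ℂ (b (J i)) (r • x)) =
        (r : ℂ) ^ 2 * (inner ℂ (b (I i)) x * starRingEnd ℂ (inner ℂ (b (J i)) x)) := fun i => by
      rw [← Complex.coe_smul r x, inner_smul_right, inner_smul_right, map_mul, Complex.conj_ofReal]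
      ring
    simp_rw [this]
    rw [Finset.prod_mul_distrib, Finset.prod_const, Finset.card_univ, Fintype.card_fin, pow_mul]
  set K := ∫ r : Set.Ioi (0 : ℝ), (r : ℂ) ^ (2 * N) * ((Real.exp (-(r : ℝ) ^ 2) : ℝ) : ℂ)
          ∂Measure.volumeIoiPow (Module.finrank ℝ H - 1)
  have key : ∀ I J, (∫ u : Metric.sphere (0 : H) 1, F I J u ∂μ.toSphere) * K =
      κ * if ∃ σ : Equiv.Perm (Fin N), I ∘ σ = J then
        (Real.pi : ℂ) ^ Module.finrank ℂ H *
          Fintype.card {g : Equiv.Perm (Fin N) // I ∘ g = I} else 0 := by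
    intro I J
    rw [← integral_homogeneous_mul_gaussian μ (2 * N) (hF I J), ← integral_monomial_mul_gaussian]
    let G : (Fin (Module.finrank ℂ H) → ℂ) → ℂ := fun z =>
      (∏ i, z (I i) * starRingEnd ℂ (z (J i))) * ((Real.exp (-∑ k, ‖z k‖ ^ 2) : ℝ) : ℂ)
    have h1 : ∀ x : H, F I J x * ((Real.exp (-‖x‖ ^ 2) : ℝ) : ℂ) = G (φ x) := fun x => by
      simp only [G, F, hnorm x, hφ]
    rw [integral_congr_ae (Filter.Eventually.of_forall h1)]
    refine (φ.toHomeomorph.measurableEmbedding.integral_map G).symm.trans ?_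
    change ∫ z, G z ∂(μ.map φ) = _
    rw [hκ, integral_smul_nnreal_measure]
    rfl
  refine ⟨((μ.toSphere Set.univ)⁻¹).toReal * (κ * (Real.pi : ℂ) ^ Module.finrank ℂ H / K),
    fun I J => ?_⟩
  -- The radial integral need not be evaluated: it cannot vanish, because the Gaussian moment with
  -- `J = I` does not.
  have hK : K ≠ 0 := by
    intro hK
    have := key I I
    rw [hK, mul_zero, if_pos ⟨1, rfl⟩] at this
    have hc : (Fintype.card {g : Equiv.Perm (Fin N) // I ∘ g = I} : ℂ) ≠ 0 := by
      have : Nonempty {g : Equiv.Perm (Fin N) // I ∘ g = I} := ⟨⟨1, rfl⟩⟩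
      exact_mod_cast Fintype.card_ne_zero
    have hpi : (Real.pi : ℂ) ^ Module.finrank ℂ H ≠ 0 :=
      pow_ne_zero _ (by exact_mod_cast Real.pi_ne_zero)
    exact mul_ne_zero hκ0 (mul_ne_zero hpi hc) this.symm
  have h2 := eq_div_of_mul_eq hK (key I J)
  change ∫ u : Metric.sphere (0 : H) 1, F I J u ∂((μ.toSphere Set.univ)⁻¹ • μ.toSphere) = _
  rw [integral_smul_measure, h2, Complex.real_smul]
  split_ifs <;> ring

end Gaussian

/-! ### Resolution of the identity by product states -/

section Resolution

open MeasureTheory InnerProductSpace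

variable {H : Type*} [NormedAddCommGroup H] [InnerProductSpace ℂ H] [FiniteDimensional ℂ H]

theorem continuous_tpow (N : ℕ) : Continuous (tpow N : H → NBody H N) := by
  have : (tpow N : H → NBody H N) = fun u =>
      ∑ I, (∏ i, inner ℂ (stdOrthonormalBasis ℂ H (I i)) u) • prodBasis H N I := by
    funext u
    rw [← (prodBasis H N).sum_repr (tpow N u)]
    exact Finset.sum_congr rfl fun I _ => by rw [tpow, prodBasis_repr_tprod]
  rw [this]
  fun_prop

theorem inner_tpow (N : ℕ) (u v : H) : inner ℂ (tpow N u) (tpow N v) = inner ℂ u v ^ N := by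
  rw [tpow, tpow, inner_tprod, Finset.prod_const, Finset.card_univ, Fintype.card_fin]

theorem inner_tpow_self_of_mem_sphere (N : ℕ) (u : Metric.sphere (0 : H) 1) :
    inner ℂ (tpow N (u : H)) (tpow N (u : H)) = 1 := by
  rw [inner_tpow, inner_self_eq_norm_sq_to_K, norm_eq_of_mem_sphere]
  simp

omit [FiniteDimensional ℂ H] in
theorem permute_tpow {N : ℕ} (σ : Equiv.Perm (Fin N)) (u : H) :
    permute σ (tpow N u) = tpow N u :=
  permute_tprod σ _

omit [FiniteDimensional ℂ H] in
theorem tpow_mem_bosonic (N : ℕ) (u : H) : tpow N u ∈ bosonic H N :=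
  mem_bosonic.2 fun σ => permute_tpow σ u

theorem inner_prodBasis {N : ℕ} (I : Fin N → Fin (Module.finrank ℂ H)) (x : NBody H N) :
    inner ℂ (prodBasis H N I) x = (prodBasis H N).repr x I := by
  have h : inner ℂ (prodBasis H N I) x =
      ∑ J, (starRingEnd ℂ) ((prodBasis H N).repr (prodBasis H N I) J) *
        (prodBasis H N).repr x J := rfl
  rw [h, Finset.sum_eq_single I]
  · simp
  · intro J _ hJ
    simp [hJ.symm]
  · simp

theorem finrank_bosonic_pos [Nontrivial H] (N : ℕ) : 0 < Module.finrank ℂ (bosonic H N) := by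
  rw [finrank_bosonic, Nat.multichoose_eq]
  have := Module.finrank_pos (R := ℂ) (M := H)
  exact Nat.choose_pos (by omega)

/-- If `H` is zero, so is the space of N ≥ 1 particles, and no operator on it has trace one. For N =
0 this fails, since that space is a copy of ℂ. -/
theorem nontrivial_of_isBosonicState {N : ℕ} (hN : 1 ≤ N) {Γ : NBody H N →L[ℂ] NBody H N}
    (hΓ : IsBosonicState Γ) : Nontrivial H := by
  by_contra h
  rw [not_nontrivial_iff_subsingleton] at h
  have : NeZero N := ⟨by omega⟩
  have h0 : Module.finrank ℂ H = 0 := Module.finrank_zero_of_subsingleton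
  have : IsEmpty (Fin N → Fin (Module.finrank ℂ H)) := by
    rw [h0]
    exact ⟨fun f => (f 0).elim0⟩
  have : Subsingleton (NBody H N) :=
    ⟨fun x y => (prodBasis H N).ext_elem fun I => isEmptyElim I⟩
  have h1 := hΓ.trace_eq_one
  rw [Subsingleton.elim Γ.toLinearMap 0, map_zero] at h1
  exact zero_ne_one h1

variable [MeasurableSpace H] [BorelSpace H]

instance [Nontrivial H] : IsProbabilityMeasure (uniformSphere H) := by
  have : FiniteDimensional ℝ H := FiniteDimensional.complexToReal H
  have : NeZero (Module.finBasis ℝ H).addHaar.toSphere := ⟨Measure.toSphere_ne_zero _⟩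
  exact isProbabilityMeasureSMul

theorem integrable_sphere {F : Type*} [NormedAddCommGroup F]
    (μ : Measure (Metric.sphere (0 : H) 1)) [IsFiniteMeasure μ]
    {f : Metric.sphere (0 : H) 1 → F} (hf : Continuous f) : Integrable f μ := by
  have : ProperSpace H := FiniteDimensional.proper ℂ H
  exact hf.integrable_of_hasCompactSupport (HasCompactSupport.of_compactSpace f)

omit [MeasurableSpace H] [BorelSpace H] in
theorem continuous_rankOne_tpow (N : ℕ) :
    Continuous fun u : Metric.sphere (0 : H) 1 =>
      rankOne ℂ (tpow N (u : H)) (tpow N (u : H)) := by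
  have h : Continuous fun u : Metric.sphere (0 : H) 1 => tpow N (u : H) :=
    (continuous_tpow N).comp continuous_subtype_val
  refine (continuous_clm_apply (𝕜 := ℂ)).2 fun x => ?_
  simp only [rankOne_apply]
  fun_prop

/-- In finite dimension every linear map is continuous and so commutes with the integral; matrix
elements and traces of superpositions are all computed this way. -/
theorem map_superposition {F : Type*} [NormedAddCommGroup F] [NormedSpace ℂ F] [CompleteSpace F]
    {N : ℕ} (μ : Measure (Metric.sphere (0 : H) 1)) [IsFiniteMeasure μ]
    (L : (NBody H N →L[ℂ] NBody H N) →ₗ[ℂ] F) :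
    L (superposition N μ) = ∫ u : Metric.sphere (0 : H) 1,
      L (rankOne ℂ (tpow N (u : H)) (tpow N (u : H))) ∂μ :=
  ((LinearMap.toContinuousLinearMap L).integral_comp_comm
    (integrable_sphere μ (continuous_rankOne_tpow N))).symm

theorem superposition_apply {N : ℕ} (μ : Measure (Metric.sphere (0 : H) 1)) [IsFiniteMeasure μ]
    (x : NBody H N) : superposition N μ x = ∫ u : Metric.sphere (0 : H) 1,
      inner ℂ (tpow N (u : H)) x • tpow N (u : H) ∂μ :=
  map_superposition μ (ContinuousLinearMap.apply ℂ _ x).toLinearMap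

theorem inner_superposition_apply {N : ℕ} (μ : Measure (Metric.sphere (0 : H) 1))
    [IsFiniteMeasure μ] (x y : NBody H N) :
    inner ℂ x (superposition N μ y) = ∫ u : Metric.sphere (0 : H) 1,
      inner ℂ (tpow N (u : H)) y * inner ℂ x (tpow N (u : H)) ∂μ := by
  have := map_superposition (N := N) μ
    ((innerSL ℂ x).toLinearMap ∘ₗ (ContinuousLinearMap.apply ℂ _ y).toLinearMap)
  simpa [inner_smul_right] using this

theorem trace_comp_superposition {N : ℕ} (μ : Measure (Metric.sphere (0 : H) 1))
    [IsFiniteMeasure μ] (A : NBody H N →ₗ[ℂ] NBody H N) :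
    LinearMap.trace ℂ (NBody H N) (A ∘ₗ (superposition N μ).toLinearMap) =
      ∫ u : Metric.sphere (0 : H) 1, inner ℂ (tpow N (u : H)) (A (tpow N (u : H))) ∂μ := by
  have := map_superposition (N := N) μ
    (LinearMap.trace ℂ (NBody H N) ∘ₗ LinearMap.mulLeft ℂ A ∘ₗ
      (ContinuousLinearMap.coeLM ℂ : (NBody H N →L[ℂ] NBody H N) →ₗ[ℂ] _))
  refine this.trans (integral_congr_ae (Filter.Eventually.of_forall fun u => ?_))
  beta_reduce
  have h := trace_rankOne (𝕜 := ℂ) (A (tpow N (u : H))) (tpow N (u : H))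
  rw [← h]
  simp only [LinearMap.comp_apply]
  congr 1
  ext x
  simp

theorem permute_superposition {N : ℕ} (μ : Measure (Metric.sphere (0 : H) 1))
    [IsFiniteMeasure μ] (σ : Equiv.Perm (Fin N)) (x : NBody H N) :
    permute σ (superposition N μ x) = superposition N μ x := by
  rw [superposition_apply]
  have := map_superposition (N := N) μ
    (permute σ ∘ₗ (ContinuousLinearMap.apply ℂ _ x).toLinearMap)
  simp only [LinearMap.comp_apply, ContinuousLinearMap.coe_coe, ContinuousLinearMap.apply_apply,
    rankOne_apply, map_smul, permute_tpow] at this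
  rw [← superposition_apply] at this ⊢
  exact this

theorem isPositive_superposition {N : ℕ} (μ : Measure (Metric.sphere (0 : H) 1))
    [IsFiniteMeasure μ] : (superposition N μ).IsPositive := by
  rw [ContinuousLinearMap.isPositive_iff_complex]
  intro x
  have h : inner ℂ x (superposition N μ x) = ((∫ u : Metric.sphere (0 : H) 1,
      Complex.normSq (inner ℂ x (tpow N (u : H))) ∂μ : ℝ) : ℂ) := by
    rw [inner_superposition_apply, ← integral_complex_ofReal]
    refine integral_congr_ae (Filter.Eventually.of_forall fun u => ?_)
    simp only [Complex.normSq_eq_conj_mul_self, inner_conj_symm]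
  rw [← inner_conj_symm, h, Complex.conj_ofReal]
  exact ⟨congrArg Complex.ofReal (Complex.ofReal_re _),
    (integral_nonneg fun _ => Complex.normSq_nonneg _).trans_eq (Complex.ofReal_re _).symm⟩

/-- The permutations taking `I` to `J` are empty or a coset of the stabilizer of `I`. This turns the
case distinction in the moments into a sum over permutations. -/
theorem card_perm_comp_eq {α : Type*} [DecidableEq α] {N : ℕ} (I J : Fin N → α) :
    (if ∃ σ : Equiv.Perm (Fin N), I ∘ σ = J then
      Fintype.card {g : Equiv.Perm (Fin N) // I ∘ g = I} else 0) =
    Fintype.card {g : Equiv.Perm (Fin N) // I ∘ g = J} := by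
  split_ifs with h
  · obtain ⟨σ, rfl⟩ := h
    refine Fintype.card_congr ((Equiv.mulRight σ).subtypeEquiv fun g => ?_)
    rw [Equiv.coe_mulRight, Equiv.Perm.coe_mul, ← Function.comp_assoc]
    exact (σ.surjective.injective_comp_right.eq_iff).symm
  · exact (Fintype.card_eq_zero_iff.2 ⟨fun g => h ⟨g.1, g.2⟩⟩).symm

/-- The (I, J) matrix element is C times the number of g with I ∘ g = J. Hence the I-th coordinate
of the image of x is C ∑_g x_(I∘g), which is C N! x_I when x is symmetric. -/
theorem exists_superposition_uniform_apply [Nontrivial H] (N : ℕ) :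
    ∃ c : ℂ, ∀ x ∈ bosonic H N, superposition N (uniformSphere H) x = c • x := by
  obtain ⟨C, hC⟩ := exists_integral_sphere_monomial (H := H) N
  refine ⟨C * N.factorial, fun x hx => (prodBasis H N).ext_elem fun I => ?_⟩
  rw [← inner_prodBasis, inner_superposition_apply]
  have h1 : ∀ u : Metric.sphere (0 : H) 1,
      inner ℂ (tpow N (u : H)) x * inner ℂ (prodBasis H N I) (tpow N (u : H)) =
      ∑ J, (prodBasis H N).repr x J * ∏ i, (inner ℂ (stdOrthonormalBasis ℂ H (I i)) (u : H) *
        starRingEnd ℂ (inner ℂ (stdOrthonormalBasis ℂ H (J i)) (u : H))) := fun u => by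
    have h2 : inner ℂ (tpow N (u : H)) x =
      ∑ J, (starRingEnd ℂ) ((prodBasis H N).repr (tpow N (u : H)) J) *
        (prodBasis H N).repr x J := rfl
    rw [h2, inner_prodBasis, Finset.sum_mul]
    refine Finset.sum_congr rfl fun J _ => ?_
    rw [tpow, prodBasis_repr_tprod, prodBasis_repr_tprod, Finset.prod_mul_distrib, map_prod]
    ring
  simp_rw [h1]
  rw [integral_finsetSum _ fun J _ => integrable_sphere _ (by fun_prop)]
  simp_rw [integral_const_mul, hC]
  have h3 : ∀ J, (prodBasis H N).repr x J * (if ∃ σ : Equiv.Perm (Fin N), I ∘ σ = J then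
        C * Fintype.card {g : Equiv.Perm (Fin N) // I ∘ g = I} else 0) =
      ∑ g : Equiv.Perm (Fin N), if I ∘ g = J then C * (prodBasis H N).repr x J else 0 := by
    intro J
    rw [← Finset.sum_filter, Finset.sum_const, ← Fintype.card_subtype, ← card_perm_comp_eq I J]
    split_ifs
    · rw [nsmul_eq_mul]
      ring
    · simp
  simp_rw [h3]
  rw [Finset.sum_comm]
  simp only [Finset.sum_ite_eq, Finset.mem_univ, if_true]
  simp_rw [mem_bosonic_iff_repr.1 hx _ I]
  rw [Finset.sum_const, Finset.card_univ, Fintype.card_perm, Fintype.card_fin, nsmul_eq_mul,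
    map_smul, Finsupp.smul_apply, smul_eq_mul]
  ring

/-- Resolution of the identity on the bosonic subspace by product states. -/
theorem finrank_smul_superposition_uniform_apply [Nontrivial H] {N : ℕ} {x : NBody H N}
    (hx : x ∈ bosonic H N) :
    (Module.finrank ℂ (bosonic H N) : ℂ) • superposition N (uniformSphere H) x = x := by
  obtain ⟨c, hc⟩ := exists_superposition_uniform_apply (H := H) N
  have htr : LinearMap.trace ℂ (NBody H N) (superposition N (uniformSphere H)).toLinearMap = 1 := by
    have := trace_comp_superposition (N := N) (uniformSphere H) LinearMap.id
    simp only [LinearMap.id_comp, LinearMap.id_apply, inner_tpow_self_of_mem_sphere] at this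
    simpa using this
  have hmem : ∀ x, superposition N (uniformSphere H) x ∈ bosonic H N := fun x =>
    mem_bosonic.2 fun σ => permute_superposition _ σ x
  -- The superposition S has bosonic range, so c = 0 would give S² = 0; being self-adjoint, S would
  -- vanish, against its trace one.
  have hc0 : c ≠ 0 := by
    rintro rfl
    have h2 : (superposition N (uniformSphere H)).toLinearMap ∘ₗ
        (superposition N (uniformSphere H)).toLinearMap = 0 := by
      ext y
      simpa using hc _ (hmem y)
    have h4 : (superposition N (uniformSphere H)).toLinearMap = 0 := by
      ext y
      have h5 := (isPositive_superposition (N := N) (uniformSphere H)).isSelfAdjoint.isSymmetric y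
        (superposition N (uniformSphere H) y)
      have h6 := LinearMap.congr_fun h2 y
      simp only [LinearMap.comp_apply, ContinuousLinearMap.coe_coe, LinearMap.zero_apply] at h5 h6
      rw [h6, inner_zero_right] at h5
      simpa using inner_self_eq_zero.1 h5
    rw [h4, map_zero] at htr
    exact zero_ne_one htr
  -- The trace c⁻¹ of this projection is the dimension of its range, which determines c.
  have hproj : LinearMap.IsProj (bosonic H N)
      (c⁻¹ • (superposition N (uniformSphere H)).toLinearMap) :=
    ⟨fun y => Submodule.smul_mem _ _ (hmem y), fun y hy => by
      simp [hc y hy, smul_smul, inv_mul_cancel₀ hc0]⟩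
  have h1 := hproj.trace
  rw [map_smul, htr, smul_eq_mul, mul_one] at h1
  rw [← h1, hc x hx, smul_smul, inv_mul_cancel₀ hc0, one_smul]

end Resolution

/-! ### Integral formulas for reduced density matrices -/

section Reduced

open MeasureTheory InnerProductSpace

variable {H : Type*} [NormedAddCommGroup H] [InnerProductSpace ℂ H] [FiniteDimensional ℂ H]

theorem tprod_induction {N : ℕ} {p : NBody H N → Prop} (x : NBody H N)
    (htprod : ∀ u : Fin N → H, p (tprod u)) (hzero : p 0) (hadd : ∀ x y, p x → p y → p (x + y))
    (hsmul : ∀ (a : ℂ) (x), p x → p (a • x)) : p x := by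
  refine Submodule.span_induction (p := fun x _ => p x) ?_ hzero (fun x y _ _ => hadd x y)
    (fun a x _ => hsmul a x) ((prodBasis H N).mem_span x)
  rintro _ ⟨I, rfl⟩
  rw [prodBasis_apply]
  exact htprod _

theorem inner_join_tmul {n N : ℕ} (h : n ≤ N) (x x' : NBody H n) (y y' : NBody H (N - n)) :
    inner ℂ (join h (x ⊗ₜ y)) (join h (x' ⊗ₜ y')) = inner ℂ x x' * inner ℂ y y' := by
  have hj : ∀ (a : Fin n → H) (b : Fin (N - n) → H), ∃ u : Fin N → H,
      (fun i => u (Fin.castLE h i)) = a ∧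
        (fun j : Fin (N - n) => u (Fin.cast (Nat.add_sub_cancel' h) (Fin.natAdd n j))) = b := by
    intro a b
    refine ⟨fun k => Fin.append a b (Fin.cast (Nat.add_sub_cancel' h).symm k), ?_, ?_⟩
    · funext i
      exact Fin.append_left a b i
    · funext j
      exact Fin.append_right a b j
  induction x using tprod_induction with
  | hzero => simp
  | hadd x₁ x₂ h₁ h₂ => simp only [TensorProduct.add_tmul, map_add, inner_add_left, h₁, h₂, add_mul]
  | hsmul c x hx =>
    simp only [← TensorProduct.smul_tmul', map_smul, inner_smul_left, hx, mul_assoc]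
  | htprod a =>
  induction y using tprod_induction with
  | hzero => simp
  | hadd x₁ x₂ h₁ h₂ => simp only [TensorProduct.tmul_add, map_add, inner_add_left, h₁, h₂, mul_add]
  | hsmul c x hx =>
    simp only [TensorProduct.tmul_smul, map_smul, inner_smul_left, hx]
    ring
  | htprod b =>
  induction x' using tprod_induction with
  | hzero => simp
  | hadd x₁ x₂ h₁ h₂ =>
    simp only [TensorProduct.add_tmul, map_add, inner_add_right, h₁, h₂, add_mul]
  | hsmul c x hx =>
    simp only [← TensorProduct.smul_tmul', map_smul, inner_smul_right, hx, mul_assoc]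
  | htprod a' =>
  induction y' using tprod_induction with
  | hzero => simp
  | hadd x₁ x₂ h₁ h₂ =>
    simp only [TensorProduct.tmul_add, map_add, inner_add_right, h₁, h₂, mul_add]
  | hsmul c x hx =>
    simp only [TensorProduct.tmul_smul, map_smul, inner_smul_right, hx]
    ring
  | htprod b' =>
    obtain ⟨u, rfl, rfl⟩ := hj a b
    obtain ⟨u', rfl, rfl⟩ := hj a' b'
    rw [join_tprod, join_tprod, inner_tprod, inner_tprod, inner_tprod,
      ← Equiv.prod_comp (finCongr (Nat.add_sub_cancel' h)), Fin.prod_univ_add]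
    rfl

theorem join_tpow {n N : ℕ} (h : n ≤ N) (u : H) :
    join h (tpow n u ⊗ₜ tpow (N - n) u) = tpow N u :=
  join_tprod h fun _ => u

theorem inner_tpow_join {n N : ℕ} (h : n ≤ N) (w : NBody H n) (u : Metric.sphere (0 : H) 1) :
    inner ℂ (tpow N (u : H)) (join h (w ⊗ₜ tpow (N - n) (u : H))) =
      inner ℂ (tpow n (u : H)) w := by
  rw [← join_tpow h, inner_join_tmul, inner_tpow_self_of_mem_sphere, mul_one]

/-- The observable `|w⟩⟨w| ⊗ B`, acting on the `N`-body space. -/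
def observable {n N : ℕ} (h : n ≤ N) (w : NBody H n) :
    (NBody H (N - n) →ₗ[ℂ] NBody H (N - n)) →ₗ[ℂ] (NBody H N →ₗ[ℂ] NBody H N) :=
  (join h).conj.toLinearMap ∘ₗ TensorProduct.mapBilinear (.id ℂ) _ _ _ _ (rankOne ℂ w w).toLinearMap

theorem observable_apply {n N : ℕ} (h : n ≤ N) (w : NBody H n)
    (B : NBody H (N - n) →ₗ[ℂ] NBody H (N - n)) (z : NBody H N) :
    observable h w B z =
      join h (TensorProduct.map (rankOne ℂ w w).toLinearMap B ((join h).symm z)) :=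
  rfl

theorem observable_join {n N : ℕ} (h : n ≤ N) (w : NBody H n)
    (B : NBody H (N - n) →ₗ[ℂ] NBody H (N - n)) (x : NBody H n) (y : NBody H (N - n)) :
    observable h w B (join h (x ⊗ₜ y)) = inner ℂ w x • join h (w ⊗ₜ B y) := by
  rw [observable_apply, LinearEquiv.symm_apply_apply, TensorProduct.map_tmul,
    ContinuousLinearMap.coe_coe, rankOne_apply, ← TensorProduct.smul_tmul', map_smul]

theorem observable_tpow {n N : ℕ} (h : n ≤ N) (w : NBody H n)
    (B : NBody H (N - n) →ₗ[ℂ] NBody H (N - n)) (u : H) :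
    observable h w B (tpow N u) = inner ℂ w (tpow n u) • join h (w ⊗ₜ B (tpow (N - n) u)) := by
  rw [← join_tpow h, observable_join]

theorem observable_rankOne {n N : ℕ} (h : n ≤ N) (w : NBody H n) (y : NBody H (N - n)) :
    observable h w (rankOne ℂ y y).toLinearMap =
      (rankOne ℂ (join h (w ⊗ₜ y)) (join h (w ⊗ₜ y))).toLinearMap := by
  refine LinearMap.ext fun z => ?_
  obtain ⟨t, rfl⟩ := (join h).surjective z
  induction t with
  | zero => simp
  | add a b ha hb => simp only [map_add, ha, hb]
  | tmul a b =>
    rw [observable_join]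
    simp only [ContinuousLinearMap.coe_coe, rankOne_apply, inner_join_tmul,
      TensorProduct.tmul_smul, map_smul, smul_smul]

/-- The defining property of the partial trace, applied to |w⟩⟨w| and transported along `join`. -/
theorem inner_reduced {n N : ℕ} (h : n ≤ N) (Γ : NBody H N →L[ℂ] NBody H N) (w : NBody H n) :
    inner ℂ w (reduced h Γ w) =
      LinearMap.trace ℂ (NBody H N) (observable h w LinearMap.id ∘ₗ Γ.toLinearMap) := by
  have h1 : inner ℂ w (reduced h Γ w) = LinearMap.trace ℂ (NBody H n)
      ((rankOne ℂ w w).toLinearMap ∘ₗ (reduced h Γ).toLinearMap) := by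
    rw [LinearMap.trace_comp_comm', ← ContinuousLinearMap.toLinearMap_comp,
      comp_rankOne, trace_rankOne]
  have h2 : (reduced h Γ).toLinearMap =
      partialTrace (NBody H n) (NBody H (N - n)) ((join h).symm.conj Γ.toLinearMap) := rfl
  rw [h1, h2, trace_mul_partialTrace, ← LinearMap.trace_conj' _ (join h)]
  congr 1
  refine LinearMap.ext fun z => ?_
  rw [LinearEquiv.conj_apply_apply, LinearMap.comp_apply, LinearMap.comp_apply, observable_apply,
    LinearEquiv.conj_apply_apply, LinearEquiv.symm_symm, LinearEquiv.apply_symm_apply]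

theorem trace_reduced {n N : ℕ} (h : n ≤ N) (Γ : NBody H N →L[ℂ] NBody H N) :
    LinearMap.trace ℂ (NBody H n) (reduced h Γ).toLinearMap =
      LinearMap.trace ℂ (NBody H N) Γ.toLinearMap := by
  have h2 := trace_mul_partialTrace LinearMap.id ((join h).symm.conj Γ.toLinearMap)
  rw [TensorProduct.map_id, LinearMap.id_comp, LinearMap.id_comp, LinearMap.trace_conj'] at h2
  exact h2

variable [MeasurableSpace H] [BorelSpace H]

/-- By the resolution of the identity, a bosonic vector is an integral of multiples of product
vectors. -/
theorem eq_on_bosonic_of_eq_on_tpow [Nontrivial H] {N : ℕ} {A B : NBody H N →ₗ[ℂ] NBody H N}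
    (hAB : ∀ u : H, A (tpow N u) = B (tpow N u)) {x : NBody H N} (hx : x ∈ bosonic H N) :
    A x = B x := by
  have h : ∀ C : NBody H N →ₗ[ℂ] NBody H N, C (superposition N (uniformSphere H) x) =
      ∫ u : Metric.sphere (0 : H) 1, inner ℂ (tpow N (u : H)) x • C (tpow N (u : H))
        ∂uniformSphere H := fun C => by
    have := map_superposition (N := N) (uniformSphere H)
      (C ∘ₗ (ContinuousLinearMap.apply ℂ _ x).toLinearMap)
    simpa using this
  rw [← finrank_smul_superposition_uniform_apply hx, map_smul, map_smul, h, h]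
  simp_rw [hAB]

omit [MeasurableSpace H] [BorelSpace H] in
theorem IsBosonicState.apply_mem_bosonic {N : ℕ} {Γ : NBody H N →L[ℂ] NBody H N}
    (hΓ : IsBosonicState Γ) (x : NBody H N) : Γ x ∈ bosonic H N :=
  mem_bosonic.2 fun σ => hΓ.symm σ x

/-- The range of `Γ` is bosonic, so the resolution of the identity can be inserted to the left of
`Γ`; cyclicity of the trace does the rest. -/
theorem IsBosonicState.trace_comp [Nontrivial H] {N : ℕ} {Γ : NBody H N →L[ℂ] NBody H N}
    (hΓ : IsBosonicState Γ) (A : NBody H N →ₗ[ℂ] NBody H N) :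
    LinearMap.trace ℂ (NBody H N) (A ∘ₗ Γ.toLinearMap) =
      Module.finrank ℂ (bosonic H N) * ∫ u : Metric.sphere (0 : H) 1,
        inner ℂ (tpow N (u : H)) (Γ (A (tpow N (u : H)))) ∂uniformSphere H := by
  have h1 : Γ.toLinearMap = (Module.finrank ℂ (bosonic H N) : ℂ) •
      ((superposition N (uniformSphere H)).toLinearMap ∘ₗ Γ.toLinearMap) :=
    LinearMap.ext fun x =>
      (finrank_smul_superposition_uniform_apply (hΓ.apply_mem_bosonic x)).symm
  have h2 := trace_comp_superposition (N := N) (uniformSphere H) (Γ.toLinearMap ∘ₗ A)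
  simp only [LinearMap.comp_apply, ContinuousLinearMap.coe_coe] at h2
  rw [← h2]
  conv_lhs => rw [h1]
  rw [LinearMap.comp_smul, map_smul, smul_eq_mul, ← LinearMap.comp_assoc,
    LinearMap.trace_comp_comm', ← LinearMap.comp_assoc]

theorem IsBosonicState.inner_reduced_eq_integral_cross [Nontrivial H] {n N : ℕ} (h : n ≤ N)
    {Γ : NBody H N →L[ℂ] NBody H N} (hΓ : IsBosonicState Γ) (w : NBody H n) :
    inner ℂ w (reduced h Γ w) =
      Module.finrank ℂ (bosonic H N) * ∫ u : Metric.sphere (0 : H) 1,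
        inner ℂ w (tpow n (u : H)) *
          inner ℂ (tpow N (u : H)) (Γ (join h (w ⊗ₜ tpow (N - n) (u : H)))) ∂uniformSphere H := by
  rw [inner_reduced, hΓ.trace_comp]
  simp_rw [observable_tpow, map_smul, inner_smul_right, LinearMap.id_apply]

/-- Here the identity is resolved on the last N - n particles only, whence the smaller dimension. In
|w⟩⟨w| ⊗ 1 the factor 1 may be so replaced because the range of `Γ` is spanned by vectors u^N, whose
last N - n factors form the bosonic vector u^(N-n). -/
theorem IsBosonicState.inner_reduced_eq_integral_join [Nontrivial H] {n N : ℕ} (h : n ≤ N)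
    {Γ : NBody H N →L[ℂ] NBody H N} (hΓ : IsBosonicState Γ) (w : NBody H n) :
    inner ℂ w (reduced h Γ w) =
      Module.finrank ℂ (bosonic H (N - n)) * ∫ u : Metric.sphere (0 : H) 1,
        inner ℂ (join h (w ⊗ₜ tpow (N - n) (u : H)))
          (Γ (join h (w ⊗ₜ tpow (N - n) (u : H)))) ∂uniformSphere H := by
  have h1 : observable h w LinearMap.id ∘ₗ Γ.toLinearMap =
      (Module.finrank ℂ (bosonic H (N - n)) : ℂ) •
        (observable h w (superposition (N - n) (uniformSphere H)).toLinearMap ∘ₗ Γ.toLinearMap) := by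
    refine LinearMap.ext fun x => ?_
    have := eq_on_bosonic_of_eq_on_tpow (A := observable h w LinearMap.id)
      (B := (Module.finrank ℂ (bosonic H (N - n)) : ℂ) •
        observable h w (superposition (N - n) (uniformSphere H)).toLinearMap) (fun u => by
        rw [LinearMap.smul_apply, observable_tpow, observable_tpow, smul_comm,
          ← map_smul (join h) (Module.finrank ℂ (bosonic H (N - n)) : ℂ), ← TensorProduct.tmul_smul, ContinuousLinearMap.coe_coe,
          finrank_smul_superposition_uniform_apply (tpow_mem_bosonic _ u), LinearMap.id_apply])
      (hΓ.apply_mem_bosonic x)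
    exact this
  rw [inner_reduced, h1, map_smul, smul_eq_mul]
  congr 1
  have h2 := map_superposition (N := N - n) (uniformSphere H)
    (LinearMap.trace ℂ (NBody H N) ∘ₗ LinearMap.mulRight ℂ Γ.toLinearMap ∘ₗ observable h w ∘ₗ
      (ContinuousLinearMap.coeLM ℂ : (NBody H (N - n) →L[ℂ] NBody H (N - n)) →ₗ[ℂ] _))
  refine h2.trans (integral_congr_ae (Filter.Eventually.of_forall fun u => ?_))
  simp only [LinearMap.comp_apply, ContinuousLinearMap.coeLM_apply, observable_rankOne,
    LinearMap.mulRight_apply]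
  rw [Module.End.mul_eq_comp, LinearMap.trace_comp_comm', ← ContinuousLinearMap.toLinearMap_comp,
    comp_rankOne, trace_rankOne]

/-- Tracing particles out of a product state of unit vectors leaves the product state of the others.
-/
theorem inner_reduced_superposition {n N : ℕ} (h : n ≤ N)
    (μ : Measure (Metric.sphere (0 : H) 1)) [IsFiniteMeasure μ] (w : NBody H n) :
    inner ℂ w (reduced h (superposition N μ) w) =
      ((∫ u : Metric.sphere (0 : H) 1, Complex.normSq (inner ℂ w (tpow n (u : H))) ∂μ : ℝ) : ℂ) := by
  rw [inner_reduced, trace_comp_superposition, ← integral_complex_ofReal]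
  simp_rw [observable_tpow, inner_smul_right, LinearMap.id_apply, inner_tpow_join]
  refine integral_congr_ae (Filter.Eventually.of_forall fun u => ?_)
  simp only [← Complex.mul_conj, inner_conj_symm]

end Reduced

/-! ### The lower symbol, the operator inequality and the trace norm bound -/

section DeFinettiBound

open MeasureTheory InnerProductSpace

variable {H : Type*} [NormedAddCommGroup H] [InnerProductSpace ℂ H] [FiniteDimensional ℂ H]
  [MeasurableSpace H] [BorelSpace H]

omit [MeasurableSpace H] [BorelSpace H] in
theorem continuous_tpow_sphere (N : ℕ) :
    Continuous fun u : Metric.sphere (0 : H) 1 => tpow N (u : H) :=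
  (continuous_tpow N).comp continuous_subtype_val

/-- The density of the lower symbol. -/
def lowerDensity {N : ℕ} (Γ : NBody H N →L[ℂ] NBody H N) (u : Metric.sphere (0 : H) 1) : ℝ :=
  Module.finrank ℂ (bosonic H N) * (inner ℂ (tpow N (u : H)) (Γ (tpow N (u : H)))).re

omit [MeasurableSpace H] [BorelSpace H] in
theorem continuous_lowerDensity {N : ℕ} (Γ : NBody H N →L[ℂ] NBody H N) :
    Continuous (lowerDensity Γ) := by
  have h := continuous_tpow_sphere (H := H) N
  exact continuous_const.mul (Complex.continuous_re.comp (h.inner (Γ.continuous.comp h)))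

omit [MeasurableSpace H] [BorelSpace H] in
theorem IsBosonicState.lowerDensity_nonneg {N : ℕ} {Γ : NBody H N →L[ℂ] NBody H N}
    (hΓ : IsBosonicState Γ) (u : Metric.sphere (0 : H) 1) : 0 ≤ lowerDensity Γ u :=
  mul_nonneg (Nat.cast_nonneg _) (hΓ.isPositive.re_inner_nonneg_right (tpow N (u : H)))

theorem IsBosonicState.integral_lowerDensity [Nontrivial H] {N : ℕ}
    {Γ : NBody H N →L[ℂ] NBody H N} (hΓ : IsBosonicState Γ) :
    ∫ u, lowerDensity Γ u ∂uniformSphere H = 1 := by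
  have h1 := congrArg Complex.re (hΓ.trace_comp LinearMap.id)
  have h := continuous_tpow_sphere (H := H) N
  have hi : Integrable (fun u : Metric.sphere (0 : H) 1 =>
      inner ℂ (tpow N (u : H)) (Γ (tpow N (u : H)))) (uniformSphere H) :=
    integrable_sphere _ (h.inner (Γ.continuous.comp h))
  rw [LinearMap.id_comp, hΓ.trace_eq_one, Complex.one_re, ← Complex.ofReal_natCast,
    Complex.re_ofReal_mul] at h1
  unfold lowerDensity
  rw [integral_const_mul]
  refine Eq.trans ?_ h1.symm
  congr 1
  exact integral_re hi

theorem IsBosonicState.isProbabilityMeasure_lowerSymbol [Nontrivial H] {N : ℕ}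
    {Γ : NBody H N →L[ℂ] NBody H N} (hΓ : IsBosonicState Γ) :
    IsProbabilityMeasure (lowerSymbol Γ) := by
  refine ⟨?_⟩
  rw [lowerSymbol, withDensity_apply _ MeasurableSet.univ, Measure.restrict_univ]
  change ∫⁻ u, ENNReal.ofReal (lowerDensity Γ u) ∂uniformSphere H = 1
  rw [← ofReal_integral_eq_lintegral_ofReal
    (integrable_sphere _ (continuous_lowerDensity Γ))
    (Filter.Eventually.of_forall hΓ.lowerDensity_nonneg), hΓ.integral_lowerDensity,
    ENNReal.ofReal_one]

theorem IsBosonicState.integral_lowerSymbol {N : ℕ} {Γ : NBody H N →L[ℂ] NBody H N}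
    (hΓ : IsBosonicState Γ) (f : Metric.sphere (0 : H) 1 → ℝ) :
    ∫ u, f u ∂lowerSymbol Γ = ∫ u, lowerDensity Γ u * f u ∂uniformSphere H := by
  have h := integral_withDensity_eq_integral_toReal_smul (μ := uniformSphere H)
    (f := fun u => ENNReal.ofReal (lowerDensity Γ u))
    (continuous_lowerDensity Γ).measurable.ennreal_ofReal
    (Filter.Eventually.of_forall fun _ => ENNReal.ofReal_lt_top) f
  refine h.trans (integral_congr_ae (Filter.Eventually.of_forall fun u => ?_))
  simp only [ENNReal.toReal_ofReal (hΓ.lowerDensity_nonneg u), smul_eq_mul]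

theorem isBosonicState_superposition {N : ℕ} (μ : Measure (Metric.sphere (0 : H) 1))
    [IsProbabilityMeasure μ] : IsBosonicState (superposition N μ) where
  isPositive := isPositive_superposition μ
  trace_eq_one := by
    have := trace_comp_superposition (N := N) μ LinearMap.id
    simp only [LinearMap.id_comp, LinearMap.id_apply, inner_tpow_self_of_mem_sphere] at this
    simpa using this
  symm := permute_superposition μ

theorem inner_apply_eq_re_of_isPositive {E : Type*} [NormedAddCommGroup E]
    [InnerProductSpace ℂ E] {T : E →L[ℂ] E} (hT : T.IsPositive) (x : E) :
    inner ℂ x (T x) = ((inner ℂ x (T x)).re : ℂ) := by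
  have h : inner ℂ (T x) x = inner ℂ x (T x) := hT.isSymmetric x x
  rw [← h]
  exact ((ContinuousLinearMap.isPositive_iff_complex T).1 hT x).1.symm

/-- The formula over the last N - n particles writes the expectation as an integral of expectations
of the positive operator `Γ`. -/
theorem IsBosonicState.inner_reduced_nonneg [Nontrivial H] {n N : ℕ} (h : n ≤ N)
    {Γ : NBody H N →L[ℂ] NBody H N} (hΓ : IsBosonicState Γ) (w : NBody H n) :
    ∃ r : ℝ, 0 ≤ r ∧ inner ℂ w (reduced h Γ w) = (r : ℂ) := by
  refine ⟨Module.finrank ℂ (bosonic H (N - n)) * ∫ u : Metric.sphere (0 : H) 1,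
    (inner ℂ (join h (w ⊗ₜ tpow (N - n) (u : H)))
      (Γ (join h (w ⊗ₜ tpow (N - n) (u : H))))).re ∂uniformSphere H, ?_, ?_⟩
  · exact mul_nonneg (Nat.cast_nonneg _)
      (integral_nonneg fun u => hΓ.isPositive.re_inner_nonneg_right _)
  · rw [hΓ.inner_reduced_eq_integral_join h]
    push_cast
    rw [← integral_complex_ofReal]
    congr 1
    refine integral_congr_ae (Filter.Eventually.of_forall fun u => ?_)
    exact inner_apply_eq_re_of_isPositive hΓ.isPositive _

theorem IsBosonicState.isPositive_reduced [Nontrivial H] {n N : ℕ} (h : n ≤ N)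
    {Γ : NBody H N →L[ℂ] NBody H N} (hΓ : IsBosonicState Γ) : (reduced h Γ).IsPositive := by
  rw [ContinuousLinearMap.isPositive_iff_complex]
  intro w
  obtain ⟨r, hr, hw⟩ := hΓ.inner_reduced_nonneg h w
  rw [← inner_conj_symm, hw, Complex.conj_ofReal]
  exact ⟨congrArg Complex.ofReal (Complex.ofReal_re _), hr.trans_eq (Complex.ofReal_re _).symm⟩

/-- The reduced density matrices of the superposition of product states defined by the lower symbol
dominate a multiple of those of the state. -/
theorem IsBosonicState.re_inner_reduced_le [Nontrivial H] {n N : ℕ} (h : n ≤ N)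
    {Γ : NBody H N →L[ℂ] NBody H N} (hΓ : IsBosonicState Γ) (w : NBody H n) :
    (Module.finrank ℂ (bosonic H (N - n)) : ℝ) / Module.finrank ℂ (bosonic H N) *
        (inner ℂ w (reduced h Γ w)).re ≤
      (inner ℂ w (reduced h (superposition N (lowerSymbol Γ)) w)).re := by
  have := hΓ.isProbabilityMeasure_lowerSymbol
  set D : ℝ := (Module.finrank ℂ (bosonic H N) : ℝ) with hD
  set D' : ℝ := (Module.finrank ℂ (bosonic H (N - n)) : ℝ)
  have hDpos : 0 < D := Nat.cast_pos.2 (finrank_bosonic_pos N)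
  have hN := continuous_tpow_sphere (H := H) N
  have hn := continuous_tpow_sphere (H := H) n
  let j : Metric.sphere (0 : H) 1 → NBody H N := fun u => join h (w ⊗ₜ tpow (N - n) (u : H))
  have hj : Continuous j := by
    let L : NBody H (N - n) →ₗ[ℂ] NBody H N := (join h).toLinearMap ∘ₗ TensorProduct.mk ℂ _ _ w
    exact (LinearMap.continuous_of_finiteDimensional L).comp
      (continuous_tpow_sphere (H := H) (N - n))
  let fA : Metric.sphere (0 : H) 1 → ℂ := fun u => inner ℂ (j u) (Γ (j u))
  let fB : Metric.sphere (0 : H) 1 → ℂ := fun u =>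
    inner ℂ w (tpow n (u : H)) * inner ℂ (tpow N (u : H)) (Γ (j u))
  let fC : Metric.sphere (0 : H) 1 → ℝ := fun u =>
    (inner ℂ (tpow N (u : H)) (Γ (tpow N (u : H)))).re *
      Complex.normSq (inner ℂ w (tpow n (u : H)))
  have hfA : Integrable fA (uniformSphere H) :=
    integrable_sphere _ (hj.inner (Γ.continuous.comp hj))
  have hfB : Integrable fB (uniformSphere H) :=
    integrable_sphere _ ((continuous_const.inner hn).mul (hN.inner (Γ.continuous.comp hj)))
  have hfC : Integrable fC (uniformSphere H) :=
    integrable_sphere _ ((Complex.continuous_re.comp (hN.inner (Γ.continuous.comp hN))).mul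
      (Complex.continuous_normSq.comp (continuous_const.inner hn)))
  set q := (inner ℂ w (reduced h Γ w)).re with hq
  set q' := (inner ℂ w (reduced h (superposition N (lowerSymbol Γ)) w)).re with hq'
  have hA : D' * ∫ u, (fA u).re ∂uniformSphere H = q := by
    rw [hq, hΓ.inner_reduced_eq_integral_join h, ← Complex.ofReal_natCast, Complex.re_ofReal_mul]
    congr 1
    exact integral_re hfA
  have hB : D * ∫ u, (fB u).re ∂uniformSphere H = q := by
    rw [hq, hΓ.inner_reduced_eq_integral_cross h, ← Complex.ofReal_natCast, Complex.re_ofReal_mul]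
    congr 1
    exact integral_re hfB
  have hC : D * ∫ u, fC u ∂uniformSphere H = q' := by
    rw [hq', inner_reduced_superposition, Complex.ofReal_re, hΓ.integral_lowerSymbol,
      ← integral_const_mul]
    refine integral_congr_ae (Filter.Eventually.of_forall fun u => ?_)
    simp only [fC, lowerDensity, hD, mul_assoc]
  -- Expansion of ⟨v, Γ v⟩ ≥ 0 at v = a (w ⊗ u^(N-n)) - ⟨u^n, w⟩ u^N.
  have key : ∀ (a : ℝ) (u : Metric.sphere (0 : H) 1),
      0 ≤ a ^ 2 * (fA u).re - 2 * a * (fB u).re + fC u := by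
    intro a u
    set t := tpow N (u : H)
    set z : ℂ := inner ℂ w (tpow n (u : H)) with hz
    have h0 := hΓ.isPositive.re_inner_nonneg_right ((a : ℂ) • j u - starRingEnd ℂ z • t)
    have hsym : inner ℂ (j u) (Γ t) = starRingEnd ℂ (inner ℂ t (Γ (j u))) := by
      rw [inner_conj_symm]
      exact (hΓ.isPositive.isSelfAdjoint.isSymmetric (j u) t).symm
    have ht : inner ℂ t (Γ t) = ((inner ℂ t (Γ t)).re : ℂ) :=
      inner_apply_eq_re_of_isPositive hΓ.isPositive t
    have e : inner ℂ ((a : ℂ) • j u - starRingEnd ℂ z • t)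
        (Γ ((a : ℂ) • j u - starRingEnd ℂ z • t)) =
        ((a ^ 2 : ℝ) : ℂ) * fA u - (a : ℂ) * (fB u + starRingEnd ℂ (fB u)) + (fC u : ℂ) := by
      simp only [map_sub, map_smul, inner_sub_left, inner_sub_right, inner_smul_left,
        inner_smul_right, Complex.conj_ofReal, Complex.conj_conj, hsym, fA, fB, fC, map_mul]
      rw [Complex.ofReal_mul, ← ht, Complex.normSq_eq_conj_mul_self]
      push_cast
      ring
    rw [e, Complex.add_conj] at h0
    have e2 : (((a ^ 2 : ℝ) : ℂ) * fA u - (a : ℂ) * ((2 * (fB u).re : ℝ) : ℂ) + (fC u : ℂ)).re =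
        a ^ 2 * (fA u).re - 2 * a * (fB u).re + fC u := by
      rw [Complex.add_re, Complex.sub_re, Complex.re_ofReal_mul, Complex.re_ofReal_mul,
        Complex.ofReal_re, Complex.ofReal_re]
      ring
    exact e2 ▸ h0
  have hrA : Integrable (fun u => (fA u).re) (uniformSphere H) := hfA.re
  have hrB : Integrable (fun u => (fB u).re) (uniformSphere H) := hfB.re
  have hrAB : Integrable (fun u => (D' / D) ^ 2 * (fA u).re - 2 * (D' / D) * (fB u).re)
      (uniformSphere H) := (hrA.const_mul _).sub (hrB.const_mul _)
  -- After integration and multiplication by D, the form is (D/D') a² q - 2 a q + q', smallest at a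
  -- = D'/D since q ≥ 0; this choice gives q' ≥ (D'/D) q.
  have h1 : 0 ≤ (D' / D) ^ 2 * (∫ u, (fA u).re ∂uniformSphere H) -
      2 * (D' / D) * (∫ u, (fB u).re ∂uniformSphere H) + ∫ u, fC u ∂uniformSphere H := by
    rw [← integral_const_mul, ← integral_const_mul, ← integral_sub (hrA.const_mul _)
      (hrB.const_mul _), ← integral_add hrAB hfC]
    exact integral_nonneg (key _)
  have h2 := mul_nonneg hDpos.le h1
  have e : D * ((D' / D) ^ 2 * (∫ u, (fA u).re ∂uniformSphere H) -
      2 * (D' / D) * (∫ u, (fB u).re ∂uniformSphere H) + ∫ u, fC u ∂uniformSphere H) =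
      (D' / D) * (D' * ∫ u, (fA u).re ∂uniformSphere H) -
        2 * (D' / D) * (D * ∫ u, (fB u).re ∂uniformSphere H) +
        D * ∫ u, fC u ∂uniformSphere H := by
    field_simp
  rw [e, hA, hB, hC] at h2
  linarith

theorem IsBosonicState.traceNorm_reduced_sub_le [Nontrivial H] {n N : ℕ} (h : n ≤ N)
    {Γ : NBody H N →L[ℂ] NBody H N} (hΓ : IsBosonicState Γ) :
    traceNorm (reduced h Γ - reduced h (superposition N (lowerSymbol Γ))) ≤
      2 * (1 - (Module.finrank ℂ (bosonic H (N - n)) : ℝ) / Module.finrank ℂ (bosonic H N)) := by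
  have := hΓ.isProbabilityMeasure_lowerSymbol
  have hΓ' := isBosonicState_superposition (N := N) (lowerSymbol Γ)
  set c := (Module.finrank ℂ (bosonic H (N - n)) : ℝ) / Module.finrank ℂ (bosonic H N)
  have htr : LinearMap.trace ℂ (NBody H n) (reduced h Γ).toLinearMap = 1 := by
    rw [trace_reduced, hΓ.trace_eq_one]
  have htr' : LinearMap.trace ℂ (NBody H n)
      (reduced h (superposition N (lowerSymbol Γ))).toLinearMap = 1 := by
    rw [trace_reduced, hΓ'.trace_eq_one]
  have hpos : (reduced h (superposition N (lowerSymbol Γ)) - (c : ℂ) • reduced h Γ).IsPositive := by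
    rw [ContinuousLinearMap.isPositive_iff_complex]
    intro w
    obtain ⟨r, _, hw⟩ := hΓ.inner_reduced_nonneg h w
    obtain ⟨r', _, hw'⟩ := hΓ'.inner_reduced_nonneg h w
    have hle := hΓ.re_inner_reduced_le h w
    rw [hw, hw', Complex.ofReal_re, Complex.ofReal_re] at hle
    have e : inner ℂ w ((reduced h (superposition N (lowerSymbol Γ)) - (c : ℂ) • reduced h Γ) w) =
        ((r' - c * r : ℝ) : ℂ) := by
      rw [sub_apply, smul_apply, inner_sub_right,
        inner_smul_right, hw, hw']
      push_cast
      rfl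
    rw [← inner_conj_symm, e, Complex.conj_ofReal]
    exact ⟨congrArg Complex.ofReal (Complex.ofReal_re _),
      (sub_nonneg.2 hle).trans_eq (Complex.ofReal_re _).symm⟩
  have hc : c ≤ 1 := by
    refine div_le_one_of_le₀ ?_ (Nat.cast_nonneg _)
    rw [finrank_bosonic, finrank_bosonic]
    obtain ⟨d, hd⟩ := Nat.exists_eq_add_of_lt (Module.finrank_pos (R := ℂ) (M := H))
    rw [hd, Nat.multichoose_eq, Nat.multichoose_eq]
    have e : ∀ k, (0 + d + 1 + k - 1).choose k = (k + d).choose d := fun k => by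
      rw [← Nat.choose_symm_add]
      congr 1
      omega
    rw [e, e]
    exact_mod_cast Nat.choose_le_choose d (by omega)
  exact traceNorm_sub_le_of_smul_le (hΓ.isPositive_reduced h) hc hpos htr htr'

end DeFinettiBound

end DeFinetti

end

theorem mainTheorem5 {H : Type*} [NormedAddCommGroup H] [InnerProductSpace ℂ H]
    [FiniteDimensional ℂ H] [MeasurableSpace H] [BorelSpace H]
    (d N : ℕ) (hd : Module.finrank ℂ H = d) (hN : 1 ≤ N)
    (Γ : DeFinetti.NBody H N →L[ℂ] DeFinetti.NBody H N) (hΓ : DeFinetti.IsBosonicState Γ) :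
    MeasureTheory.IsProbabilityMeasure (DeFinetti.lowerSymbol Γ) ∧
    MeasureTheory.Integrable
      (fun u : Metric.sphere (0 : H) 1 => InnerProductSpace.rankOne ℂ
        (DeFinetti.tpow N (u : H)) (DeFinetti.tpow N (u : H))) (DeFinetti.lowerSymbol Γ) ∧
    DeFinetti.IsBosonicState (DeFinetti.superposition N (DeFinetti.lowerSymbol Γ)) ∧
    ∀ (n : ℕ) (hn : n ≤ N), 1 ≤ n →
      DeFinetti.traceNorm (DeFinetti.reduced hn Γ -
        DeFinetti.reduced hn (DeFinetti.superposition N (DeFinetti.lowerSymbol Γ))) ≤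
      2 * (n : ℝ) * ((d : ℝ) + 2 * (n : ℝ)) / (N : ℝ) := by
  have : Nontrivial H := DeFinetti.nontrivial_of_isBosonicState hN hΓ
  have hp := hΓ.isProbabilityMeasure_lowerSymbol
  refine ⟨hp, DeFinetti.integrable_sphere _ (DeFinetti.continuous_rankOne_tpow N),
    DeFinetti.isBosonicState_superposition _, fun n hn _ => ?_⟩
  refine (hΓ.traceNorm_reduced_sub_le hn).trans ?_
  have hD : (0 : ℝ) < Module.finrank ℂ (DeFinetti.bosonic H N) := by
    exact_mod_cast DeFinetti.finrank_bosonic_pos (H := H) N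
  have hr := (le_div_iff₀ hD).2 (DeFinetti.finrank_bosonic_ratio (H := H) hN hn)
  -- The argument yields 2nd/N; the additional 2n in the stated bound is slack.
  have hle : (n : ℝ) * d / N ≤ n * (d + 2 * n) / N := by
    gcongr
    linarith [(Nat.cast_nonneg n : (0 : ℝ) ≤ n)]
  rw [hd] at hr
  calc _ ≤ 2 * ((n : ℝ) * d / N) := by linarith
    _ ≤ 2 * (n * (d + 2 * n) / N) := by linarith
    _ = _ := by ring
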